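/- Let $P\subset\mathbb{R}^2$ be a convex lattice polygon (a two-dimensional convex hull of finitely many points of $\mathbb{Z}^2$) of area $a$, with $b$ lattice points on its boundary and $i$ lattice points in its interior. A lattice equivalence is an affine automorphism of $\mathbb{R}^2$ that maps $\mathbb{Z}^2$ onto itself. Let $\Delta=\operatorname{conv}\{(0,0),(1,0),(0,1)\}$. Let $P^{(0)}=P$ and let $P^{(k+1)}$ be the convex hull of the lattice points in the interior of $P^{(k)}$. Let $n\ge 0$ be the least number such that $P^{(n)}$ has no interior lattice points; the nucleus $P^{(n)}$ is then either degenerate (a point or a segment) or a two-dimensional polygon without interior lattice points. The level $\ell=\ell(P)$ is defined to be $n$ if the nucleus is degenerate, $n+\tfrac13$ if the nucleus is lattice equivalent to $\Delta$, $n+\tfrac23$ if it is lattice equivalent to $2\Delta$, and $n+\tfrac12$ otherwise. If $\ell\ge 1$, then $$(2\ell-1)\,b\le 2i+9\ell^2-2,\qquad 2\ell b\le 2a+9\ell^2,\qquad (4\ell-2)\,a\le 9\ell^2+4\ell(i-1)$$ (three equivalent forms of one inequality), and in each of them equality holds if and only if $P$ is a multiple of $\Delta$, that is, lattice equivalent to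 $k\Delta$ for some positive integer $k$. -/

import Mathlib

open scoped Pointwise

namespace LatticePolygon

/-- The lattice `ℤ²` inside the plane `ℝ²`. -/
def lattice : Set (ℝ × ℝ) := Set.range fun z : ℤ × ℤ => ((z.1 : ℝ), (z.2 : ℝ))

/-- Convex lattice polygons: two-dimensional convex hulls of finitely many lattice points. -/
def IsConvexLatticePolygon (P : Set (ℝ × ℝ)) : Prop :=
  (∃ V : Set (ℝ × ℝ), V.Finite ∧ V ⊆ lattice ∧ P = convexHull ℝ V) ∧ (interior P).Nonempty

/-- The area of a plane set. -/
noncomputable def area (P : Set (ℝ × ℝ)) : ℝ := (MeasureTheory.volume P).toReal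

/-- The number of lattice points on the boundary. -/
noncomputable def boundaryPoints (P : Set (ℝ × ℝ)) : ℕ := (frontier P ∩ lattice).ncard

/-- The number of lattice points in the interior. -/
noncomputable def interiorPoints (P : Set (ℝ × ℝ)) : ℕ := (interior P ∩ lattice).ncard

/-- Lattice equivalence: some affine automorphism of the plane that maps the lattice onto itself
carries `P` onto `Q`. -/
def LatticeEquivalent (P Q : Set (ℝ × ℝ)) : Prop :=
  ∃ Φ : (ℝ × ℝ) ≃ᵃ[ℝ] (ℝ × ℝ), Φ '' lattice = lattice ∧ Φ '' P = Q

/-- The standard triangle `Δ`. -/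
def standardTriangle : Set (ℝ × ℝ) := convexHull ℝ {(0, 0), (1, 0), (0, 1)}

/-- `P` is, up to lattice equivalence, a dilation `kΔ` with a positive integer `k`. -/
def IsMultipleOfStandardTriangle (P : Set (ℝ × ℝ)) : Prop :=
  ∃ k : ℕ, 0 < k ∧ LatticeEquivalent P ((k : ℝ) • standardTriangle)

/-- Peeling off one skin: the convex hull of the interior lattice points. -/
def peel (P : Set (ℝ × ℝ)) : Set (ℝ × ℝ) := convexHull ℝ (interior P ∩ lattice)

/-- The number `n` of peeling steps after which the nucleus `peel^[n] P` is reached: the first `n`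
for which `peel^[n] P` has no interior lattice points, so that it is either degenerate (a point or
a segment) or an empty nut (a two-dimensional polygon without interior lattice points). -/
noncomputable def skinCount (P : Set (ℝ × ℝ)) : ℕ :=
  sInf {n : ℕ | interior (peel^[n] P) ∩ lattice = ∅}

/-- The nucleus of `P`. -/
noncomputable def nucleus (P : Set (ℝ × ℝ)) : Set (ℝ × ℝ) := peel^[skinCount P] P

open Classical in
/-- The level `ℓ(P)`: the number of peeling steps, increased by `0`, `1/3`, `2/3` or `1/2` if the
nucleus is degenerate, is `Δ`, is `2Δ`, or is any other empty nut, respectively. -/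
noncomputable def level (P : Set (ℝ × ℝ)) : ℝ :=
  if interior (nucleus P) = ∅ then (skinCount P : ℝ)
  else if LatticeEquivalent (nucleus P) standardTriangle then (skinCount P : ℝ) + 1 / 3
  else if LatticeEquivalent (nucleus P) ((2 : ℝ) • standardTriangle) then
    (skinCount P : ℝ) + 2 / 3
  else (skinCount P : ℝ) + 1 / 2

end LatticePolygon

/-! The argument compares everything with the lattice width `p`. In coordinates where `P` projects
onto `[0, p]`, let `s` be the total length of the two end columns. An integral functional takes
integer values at lattice points, so each peeling step narrows every integral strip around the
polygon by one on each side. A two-dimensional nucleus still has width at least 1, and `2Δ` has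
width 2. Hence `2ℓ ≤ p` (`two_mul_level_le`).

Three estimates in the style of Scott remain. A column between the ends contributes at most two
boundary points, so `b ≤ s + 2p`. The trapezoid on the end columns gives `2a ≥ ps`. If `s ≤ p`, then
`4a ≥ p(p + s)`: after a shear, a point of each end column can be chosen so that the two are nearly
level, while minimality of `p` forces vertical extent at least `p`
(`IsColumns.mul_le_four_mul_area`). The bound `2ℓb ≤ 2a + 9ℓ²` is then real algebra
(`scott_real_inequality`). Equality forces `p = 3ℓ`, `s = p`, `b = 3p` and `2a = p²`, which leaves
only triangles equivalent to `pΔ`. Conversely, peeling `kΔ` gives a translate of `(k - 3)Δ`, so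
`3ℓ(kΔ) = k`.

Pick's theorem makes the three forms equivalent and also shows that lattice equivalences preserve
area. Its proof is by columns: breakpoints of the upper and lower boundary are lattice points, so
the trapezoid rule is exact, and replacing heights by the mean of floor and ceiling does not change
the sum. -/

namespace LatticePolygon

/-! ### Trapezoid sums with integer nodes -/

/-- The trapezoid rule with unit steps on `[0, d]`. -/
noncomputable def trapezoid (f : ℕ → ℝ) (d : ℕ) : ℝ :=
  ∑ k ∈ Finset.range d, (f k + f (k + 1)) / 2

theorem trapezoid_add (f : ℕ → ℝ) (a d : ℕ) :
    trapezoid f (a + d) = trapezoid f a + trapezoid (fun j => f (a + j)) d := by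
  simp [trapezoid, Finset.sum_range_add, add_assoc]

theorem trapezoid_sub (f g : ℕ → ℝ) (d : ℕ) :
    trapezoid (fun k => f k - g k) d = trapezoid f d - trapezoid g d := by
  simp only [trapezoid, ← Finset.sum_sub_distrib]
  exact Finset.sum_congr rfl fun k _ => by ring

/-- Adding the sum to its reversal leaves only symmetric pairs. Control of `f k + f (d - k)`
therefore suffices, whether `f` is affine or concave. -/
theorem two_mul_trapezoid (f : ℕ → ℝ) (d : ℕ) :
    2 * trapezoid f d = ∑ k ∈ Finset.range d,
      ((f k + f (d - k)) + (f (k + 1) + f (d - (k + 1)))) / 2 := by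
  have h : trapezoid f d = ∑ k ∈ Finset.range d, (f (d - (k + 1)) + f (d - k)) / 2 := by
    rw [trapezoid, ← Finset.sum_range_reflect]
    refine Finset.sum_congr rfl fun k hk => ?_
    have := Finset.mem_range.1 hk
    rw [show d - 1 - k = d - (k + 1) by omega, show d - (k + 1) + 1 = d - k by omega]
  rw [two_mul]
  nth_rewrite 2 [h]
  rw [trapezoid, ← Finset.sum_add_distrib]
  exact Finset.sum_congr rfl fun k _ => by ring

theorem trapezoid_eq_of_symm {f : ℕ → ℝ} {d : ℕ} {S : ℝ}
    (h : ∀ k ≤ d, f k + f (d - k) = S) : trapezoid f d = d * S / 2 := by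
  have h2 := two_mul_trapezoid f d
  rw [Finset.sum_congr rfl (g := fun _ => S)] at h2
  · simp at h2; linarith
  · intro k hk
    have := Finset.mem_range.1 hk
    rw [h k (by omega), h (k + 1) (by omega)]; ring

theorem le_trapezoid_of_symm {f : ℕ → ℝ} {d : ℕ} {S : ℝ}
    (h : ∀ k ≤ d, S ≤ f k + f (d - k)) : d * S / 2 ≤ trapezoid f d := by
  have h2 := two_mul_trapezoid f d
  have h3 : ∑ k ∈ Finset.range d, S ≤ ∑ k ∈ Finset.range d,
      ((f k + f (d - k)) + (f (k + 1) + f (d - (k + 1)))) / 2 := by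
    refine Finset.sum_le_sum fun k hk => ?_
    have := Finset.mem_range.1 hk
    linarith [h k (by omega), h (k + 1) (by omega)]
  simp at h3; linarith

theorem symm_of_trapezoid_eq {f : ℕ → ℝ} {d : ℕ} {S : ℝ}
    (h : ∀ k ≤ d, S ≤ f k + f (d - k)) (he : trapezoid f d = d * S / 2) (k : ℕ) (hk : k < d) :
    f k + f (d - k) = S := by
  have h2 := two_mul_trapezoid f d
  have hle : ∀ k ∈ Finset.range d,
      S ≤ ((f k + f (d - k)) + (f (k + 1) + f (d - (k + 1)))) / 2 := by
    intro k hk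
    have := Finset.mem_range.1 hk
    linarith [h k (by omega), h (k + 1) (by omega)]
  have h3 : ∑ k ∈ Finset.range d, S = ∑ k ∈ Finset.range d,
      ((f k + f (d - k)) + (f (k + 1) + f (d - (k + 1)))) / 2 := by
    simp; linarith
  have h4 := (Finset.sum_eq_sum_iff_of_le hle).1 h3 k (Finset.mem_range.2 hk)
  linarith [h k (by omega), h (k + 1) (by omega)]

/-! ### Piecewise linearity of the upper boundary -/

/-- `u` is the upper boundary function of the convex hull of `V` over `[0, p]`. -/
structure IsUpper (V : Set (ℝ × ℝ)) (p : ℕ) (u : ℝ → ℝ) : Prop where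
  mem : ∀ x : ℝ, 0 ≤ x → x ≤ p → (x, u x) ∈ convexHull ℝ V
  le : ∀ z ∈ convexHull ℝ V, z.2 ≤ u z.1

theorem below_line {V : Set (ℝ × ℝ)} {A C : ℝ} (h : ∀ v ∈ V, v.2 ≤ A + C * v.1) :
    ∀ z ∈ convexHull ℝ V, z.2 ≤ A + C * z.1 := by
  have hc : Convex ℝ {z : ℝ × ℝ | z.2 ≤ A + C * z.1} := by
    intro z hz w hw a b ha hb hab
    simp only [Set.mem_ofPred_eq, Prod.snd_add, Prod.smul_snd, Prod.fst_add, Prod.smul_fst,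
      smul_eq_mul] at *
    have h1 := mul_le_mul_of_nonneg_left hz ha
    have h2 := mul_le_mul_of_nonneg_left hw hb
    obtain rfl : b = 1 - a := by linarith
    linarith
  exact fun z hz => convexHull_min h hc hz

theorem combo_mem {P : Set (ℝ × ℝ)} (hP : Convex ℝ P) {x₁ y₁ x₂ y₂ x : ℝ}
    (h₁ : (x₁, y₁) ∈ P) (h₂ : (x₂, y₂) ∈ P) (hx : x₁ < x₂) (h1 : x₁ ≤ x) (h2 : x ≤ x₂) :
    (x, y₁ + (x - x₁) * ((y₂ - y₁) / (x₂ - x₁))) ∈ P := by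
  have hd : 0 < x₂ - x₁ := by linarith
  have := hP h₁ h₂ (a := (x₂ - x) / (x₂ - x₁)) (b := (x - x₁) / (x₂ - x₁))
    (div_nonneg (by linarith) hd.le) (div_nonneg (by linarith) hd.le) (by field_simp; ring)
  convert this using 1
  ext <;> simp <;> field_simp <;> ring

/-- From any point of the upper boundary over an integer one reaches the next breakpoint. -/
theorem IsUpper.next {V : Set (ℝ × ℝ)} {p : ℕ} {u : ℝ → ℝ} (hu : IsUpper V p u)
    (hV : V.Finite) (hL : V ⊆ lattice) (h0 : ∀ v ∈ V, 0 ≤ v.1 ∧ v.1 ≤ p)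
    (hp : ∃ v ∈ V, v.1 = p) (a : ℕ) (ha : a < p) :
    ∃ b : ℕ, a < b ∧ b ≤ p ∧ (∃ z : ℤ, u b = z) ∧
      ∀ t : ℝ, a ≤ t → t ≤ b → u t = u a + (t - a) * ((u b - u a) / (b - a)) := by
  have hap : (a : ℝ) < p := by exact_mod_cast ha
  have hfin : (V ∩ {v | (a : ℝ) < v.1}).Finite := hV.subset Set.inter_subset_left
  have hne : (V ∩ {v | (a : ℝ) < v.1}).Nonempty := by
    obtain ⟨v, hv, h⟩ := hp
    exact ⟨v, hv, by simpa [h] using hap⟩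
  -- The next breakpoint is a vertex of steepest slope as seen from `(a, u a)`. The line through
  -- both then supports the hull.
  obtain ⟨w, ⟨hw, hwa⟩, hmax⟩ :=
    Set.exists_max_image _ (fun v : ℝ × ℝ => (v.2 - u a) / (v.1 - a)) hfin hne
  simp only [Set.mem_ofPred_eq] at hwa
  set C := (w.2 - u a) / (w.1 - a) with hC
  have hwd : 0 < w.1 - a := by linarith
  have hw2 : w.2 = u a + C * (w.1 - a) := by rw [hC]; field_simp; ring
  have hline : ∀ v ∈ V, v.2 ≤ (u a - C * a) + C * v.1 := by
    intro v hv
    rcases lt_trichotomy v.1 a with h | h | h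
    -- A vertex to the left and above this line would have a chord to `w` passing above `(a, u a)`.
    · by_contra hcon
      push Not at hcon
      have hm := combo_mem (convex_convexHull ℝ V) (subset_convexHull ℝ V hv)
        (subset_convexHull ℝ V hw) (h.trans hwa) h.le hwa.le
      have hle := hu.le _ hm
      simp only at hle
      have hd : 0 < w.1 - v.1 := by linarith
      have : v.2 + (a - v.1) * ((w.2 - v.2) / (w.1 - v.1))
          = (v.2 * (w.1 - a) + w.2 * (a - v.1)) / (w.1 - v.1) := by field_simp; ring
      rw [this, div_le_iff₀ hd, hw2] at hle
      nlinarith [mul_pos hwd (sub_pos.2 hcon)]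
    · have := hu.le v (subset_convexHull ℝ V hv)
      rw [h] at this ⊢; linarith
    · have := hmax v ⟨hv, h⟩
      rw [div_le_iff₀ (by linarith)] at this
      linarith
  have hbelow := below_line hline
  obtain ⟨⟨zx, zy⟩, hz⟩ := hL hw
  simp only at hz
  have hzx : w.1 = zx := by rw [← hz]
  have hzy : w.2 = zy := by rw [← hz]
  have hzpos : 0 ≤ zx := by
    have := (h0 w hw).1
    rw [hzx] at this; exact_mod_cast this
  obtain ⟨b, rfl⟩ := Int.eq_ofNat_of_zero_le hzpos
  have hwb : w.1 = (b : ℝ) := by rw [hzx]; simp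
  have hbp : (b : ℝ) ≤ p := by rw [← hwb]; exact (h0 w hw).2
  have hub : u b = w.2 := by
    apply le_antisymm
    · have := hbelow _ (hu.mem b (by positivity) hbp)
      simp only at this
      rw [hw2, hwb]; linarith
    · have := hu.le w (subset_convexHull ℝ V hw)
      rwa [hwb] at this
  have hba : (a : ℝ) < b := by rw [← hwb]; exact hwa
  refine ⟨b, by exact_mod_cast hba, by exact_mod_cast hbp, ⟨zy, by rw [hub, hzy]⟩, ?_⟩
  intro t h1 h2
  rw [hub, ← hwb, ← hC]
  apply le_antisymm
  · have := hbelow _ (hu.mem t (le_trans (by positivity) h1) (h2.trans hbp))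
    simp only at this
    linarith
  · have hm := combo_mem (convex_convexHull ℝ V) (hu.mem a (by positivity) hap.le)
      (hu.mem b (by positivity) hbp) hba h1 h2
    have := hu.le _ hm
    simp only at this
    rwa [hub, ← hwb, ← hC] at this

/-- This starts the induction over breakpoints. A bound on the slopes from the highest vertex over 0
gives a line through that vertex above the hull. -/
theorem IsUpper.zero_int {V : Set (ℝ × ℝ)} {p : ℕ} {u : ℝ → ℝ} (hu : IsUpper V p u)
    (hV : V.Finite) (hL : V ⊆ lattice) (h0 : ∀ v ∈ V, 0 ≤ v.1 ∧ v.1 ≤ p)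
    (hz : ∃ v ∈ V, v.1 = 0) : ∃ z : ℤ, u 0 = z := by
  obtain ⟨v₀, hv₀, hv₀'⟩ := hz
  obtain ⟨w, ⟨hw, hw0⟩, hmax⟩ := Set.exists_max_image (V ∩ {v | v.1 = 0}) (fun v => v.2)
    (hV.subset Set.inter_subset_left) ⟨v₀, hv₀, hv₀'⟩
  simp only [Set.mem_ofPred_eq] at hw0
  obtain ⟨C, hC⟩ := ((hV.image (fun v : ℝ × ℝ => (v.2 - w.2) / v.1)).bddAbove)
  have hline : ∀ v ∈ V, v.2 ≤ w.2 + C * v.1 := by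
    intro v hv
    rcases (h0 v hv).1.lt_or_eq with h | h
    · have := hC (Set.mem_image_of_mem _ hv)
      rw [div_le_iff₀ h] at this
      linarith
    · rw [← h]; simpa using hmax v ⟨hv, h.symm⟩
  have h1 := below_line hline _ (hu.mem 0 le_rfl (by positivity))
  have h2 := hu.le w (subset_convexHull ℝ V hw)
  rw [hw0] at h2
  obtain ⟨⟨zx, zy⟩, hz⟩ := hL hw
  refine ⟨zy, ?_⟩
  have : w.2 = zy := by rw [← hz]
  simp at h1
  linarith

/-- The mean of floor and ceiling. -/
noncomputable def midRound (t : ℝ) : ℝ := ((⌊t⌋ : ℝ) + ⌈t⌉) / 2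

/-- The map `t ↦ z - t` exchanges floor and ceiling, so the rounding errors of a symmetric pair
cancel. -/
theorem midRound_add_sub (z : ℤ) (t : ℝ) : midRound t + midRound (z - t) = z := by
  have h1 : ⌊(z : ℝ) - t⌋ = z - ⌈t⌉ := by
    rw [sub_eq_add_neg, Int.floor_intCast_add, Int.floor_neg]; ring
  have h2 : ⌈(z : ℝ) - t⌉ = z - ⌊t⌋ := by
    rw [sub_eq_add_neg, Int.ceil_intCast_add, Int.ceil_neg]; ring
  rw [midRound, midRound, h1, h2]; push_cast; ring

theorem midRound_int (z : ℤ) : midRound z = z := by simp [midRound]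

/-- Integral, trapezoid rule and rounded trapezoid rule of the upper boundary agree. -/
theorem IsUpper.trapezoids {V : Set (ℝ × ℝ)} {p : ℕ} {u : ℝ → ℝ} (hu : IsUpper V p u)
    (hV : V.Finite) (hL : V ⊆ lattice) (h0 : ∀ v ∈ V, 0 ≤ v.1 ∧ v.1 ≤ p)
    (hz : ∃ v ∈ V, v.1 = 0) (hp : ∃ v ∈ V, v.1 = p) :
    IntervalIntegrable u MeasureTheory.volume 0 p ∧
      (∫ x in (0 : ℝ)..p, u x) = trapezoid (fun k => u k) p ∧
      trapezoid (fun k => midRound (u k)) p = trapezoid (fun k => u k) p ∧ ∃ z : ℤ, u p = z := by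
  -- Induction from breakpoint to breakpoint: `n` bounds the remaining distance `p - a`, and the
  -- invariant is the claim on `[0, a]`.
  have step : ∀ n a : ℕ, a ≤ p → p - a ≤ n →
      (IntervalIntegrable u MeasureTheory.volume 0 a ∧
      (∫ x in (0 : ℝ)..a, u x) = trapezoid (fun k => u k) a ∧
      trapezoid (fun k => midRound (u k)) a = trapezoid (fun k => u k) a ∧ ∃ z : ℤ, u a = z) →
      (IntervalIntegrable u MeasureTheory.volume 0 p ∧
      (∫ x in (0 : ℝ)..p, u x) = trapezoid (fun k => u k) p ∧
      trapezoid (fun k => midRound (u k)) p = trapezoid (fun k => u k) p ∧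
      ∃ z : ℤ, u p = z) := by
    intro n
    induction n with
    | zero =>
      intro a h1 h2 h
      have : a = p := by omega
      rwa [this] at h
    | succ n ih =>
      intro a h1 h2 h
      rcases h1.lt_or_eq with h1 | h1
      swap
      · rwa [h1] at h
      obtain ⟨b, hab, hbp, ⟨zb, hzb⟩, haff⟩ := hu.next hV hL h0 hp a h1
      obtain ⟨hi, hint, hround, ⟨za, hza⟩⟩ := h
      refine ih b hbp (by omega) ?_
      have habr : (a : ℝ) < b := by exact_mod_cast hab
      set C := (u b - u a) / ((b : ℝ) - a) with hC
      have hcongr : Set.EqOn (fun t : ℝ => u a + (t - a) * C) u (Set.uIcc (a : ℝ) b) := by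
        intro t ht
        rw [Set.uIcc_of_le habr.le] at ht
        exact (haff t ht.1 ht.2).symm
      have hiab : IntervalIntegrable u MeasureTheory.volume a b := by
        have : IntervalIntegrable (fun t : ℝ => u a + (t - a) * C) MeasureTheory.volume a b :=
          Continuous.intervalIntegrable (by fun_prop) _ _
        exact this.congr (fun t ht => hcongr (Set.uIoc_subset_uIcc ht))
      have hval : (∫ x in (a : ℝ)..b, u x) = (b - a) * (u a + u b) / 2 := by
        rw [← intervalIntegral.integral_congr hcongr]
        rw [intervalIntegral.integral_add (by simp) (Continuous.intervalIntegrable (by fun_prop) _ _),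
          intervalIntegral.integral_mul_const,
          intervalIntegral.integral_sub (by simp) (by simp)]
        simp only [intervalIntegral.integral_const, smul_eq_mul, integral_id]
        have : u b = u a + C * (b - a) := by
          have := sub_pos.2 habr
          rw [hC]; field_simp; ring
        rw [this]; ring
      obtain ⟨e, rfl⟩ := Nat.exists_eq_add_of_le hab.le
      have haff' : ∀ k ≤ e, u ((a + k : ℕ) : ℝ) = u a + k * C := by
        intro k hk
        rw [haff _ (by simp) (by exact_mod_cast (by omega : a + k ≤ a + e))]
        push_cast; ring
      -- On an affine piece with integral end heights, symmetric heights have a constant integral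
      -- sum. Hence both the exact and the rounded trapezoid sums depend on that sum alone.
      have hsymm : ∀ k ≤ e, u ((a + k : ℕ) : ℝ) + u ((a + (e - k) : ℕ) : ℝ)
          = ((za + zb : ℤ) : ℝ) := by
        intro k hk
        have hbb := haff' e le_rfl
        rw [haff' k hk, haff' _ (Nat.sub_le _ _), Nat.cast_sub hk]
        push_cast
        rw [← hza, ← hzb, hbb]; ring
      have ht1 : trapezoid (fun j => u ((a + j : ℕ) : ℝ)) e = e * ((za + zb : ℤ) : ℝ) / 2 :=
        trapezoid_eq_of_symm hsymm
      have ht2 : trapezoid (fun j => midRound (u ((a + j : ℕ) : ℝ))) e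
          = e * ((za + zb : ℤ) : ℝ) / 2 := by
        apply trapezoid_eq_of_symm
        intro k hk
        rw [eq_sub_of_add_eq' (hsymm k hk), midRound_add_sub]
      refine ⟨hi.trans hiab, ?_, ?_, ⟨zb, hzb⟩⟩
      · rw [← intervalIntegral.integral_add_adjacent_intervals hi hiab, hint, hval,
          trapezoid_add, ht1, hza, hzb]
        push_cast; ring
      · rw [trapezoid_add, trapezoid_add, ht1, ht2, hround]
  refine step p 0 (Nat.zero_le _) (by omega) ⟨by simp, by simp [trapezoid], by simp [trapezoid], ?_⟩
  simpa using hu.zero_int hV hL h0 hz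

/-! ### Polygons over `[0, p]` and their columns -/

/-- `V` spans a lattice polygon whose projection to the first coordinate is `[0, p]`. -/
structure IsNormalized (V : Set (ℝ × ℝ)) (p : ℕ) : Prop where
  finite : V.Finite
  sub : V ⊆ lattice
  bounds : ∀ v ∈ V, 0 ≤ v.1 ∧ v.1 ≤ p
  left : ∃ v ∈ V, v.1 = 0
  right : ∃ v ∈ V, v.1 = p
  interior_nonempty : (interior (convexHull ℝ V)).Nonempty

/-- Over `[0, p]`, the convex hull of `V` is the region between `l` and `u`. -/
structure IsColumns (V : Set (ℝ × ℝ)) (p : ℕ) (l u : ℝ → ℝ) : Prop where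
  upper : IsUpper V p u
  mem : ∀ x : ℝ, 0 ≤ x → x ≤ p → (x, l x) ∈ convexHull ℝ V
  le : ∀ z ∈ convexHull ℝ V, l z.1 ≤ z.2

theorem IsNormalized.hull_bounds {V : Set (ℝ × ℝ)} {p : ℕ} (h : IsNormalized V p)
    {z : ℝ × ℝ} (hz : z ∈ convexHull ℝ V) : 0 ≤ z.1 ∧ z.1 ≤ p := by
  have hc : Convex ℝ {z : ℝ × ℝ | 0 ≤ z.1 ∧ z.1 ≤ p} :=
    (convex_halfSpace_ge (f := fun z : ℝ × ℝ => z.1) ⟨by simp, by simp⟩ 0).inter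
      (convex_halfSpace_le (f := fun z : ℝ × ℝ => z.1) ⟨by simp, by simp⟩ (p : ℝ))
  exact convexHull_min h.bounds hc hz

theorem exists_ball_mem {P : Set (ℝ × ℝ)} {x y : ℝ} (h : (x, y) ∈ interior P) :
    ∃ ε > 0, ∀ s t : ℝ, |s| ≤ ε → |t| ≤ ε → (x + s, y + t) ∈ P := by
  obtain ⟨ε, hε, hb⟩ := Metric.mem_nhds_iff.1 (mem_interior_iff_mem_nhds.1 h)
  refine ⟨ε / 2, by positivity, fun s t hs ht => hb ?_⟩
  rw [Metric.mem_ball, Prod.dist_eq, Real.dist_eq, Real.dist_eq]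
  simp only [add_sub_cancel_left]
  exact max_lt (by linarith) (by linarith)

theorem IsNormalized.interior_bounds {V : Set (ℝ × ℝ)} {p : ℕ} (h : IsNormalized V p)
    {x y : ℝ} (hz : (x, y) ∈ interior (convexHull ℝ V)) : 0 < x ∧ x < p := by
  obtain ⟨ε, hε, hb⟩ := exists_ball_mem hz
  have h1 := h.hull_bounds (hb ε 0 (by rw [abs_of_pos hε]) (by simpa using hε.le))
  have h2 := h.hull_bounds (hb (-ε) 0 (by rw [abs_neg, abs_of_pos hε]) (by simpa using hε.le))
  simp only at h1 h2
  constructor <;> linarith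

theorem IsNormalized.pos {V : Set (ℝ × ℝ)} {p : ℕ} (h : IsNormalized V p) : 0 < p := by
  obtain ⟨⟨x, y⟩, hz⟩ := h.interior_nonempty
  have := h.interior_bounds hz
  exact_mod_cast this.1.trans this.2

theorem IsNormalized.exists_columns {V : Set (ℝ × ℝ)} {p : ℕ} (h : IsNormalized V p) :
    ∃ l u, IsColumns V p l u := by
  have hcomp : IsCompact (convexHull ℝ V) := (h.finite.isCompact_convexHull (𝕜 := ℝ))
  have key : ∀ x : ℝ, ∃ ab : ℝ × ℝ, (0 ≤ x → x ≤ p →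
      (x, ab.1) ∈ convexHull ℝ V ∧ (x, ab.2) ∈ convexHull ℝ V) ∧
      ∀ z ∈ convexHull ℝ V, z.1 = x → ab.1 ≤ z.2 ∧ z.2 ≤ ab.2 := by
    intro x
    by_cases hx : 0 ≤ x ∧ x ≤ p
    · have hS : IsCompact (convexHull ℝ V ∩ {z | z.1 = x}) :=
        hcomp.inter_right (isClosed_eq continuous_fst continuous_const)
      have hne : (convexHull ℝ V ∩ {z | z.1 = x}).Nonempty := by
        obtain ⟨v, hv, hv0⟩ := h.left
        obtain ⟨w, hw, hw0⟩ := h.right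
        have hp : (0 : ℝ) < p := by exact_mod_cast h.pos
        exact ⟨_, combo_mem (convex_convexHull ℝ V) (subset_convexHull ℝ V hv)
          (subset_convexHull ℝ V hw) (by rw [hv0, hw0]; exact hp) (by rw [hv0]; exact hx.1)
          (by rw [hw0]; exact hx.2), rfl⟩
      obtain ⟨b, hb, hb'⟩ := hS.exists_isMaxOn hne continuous_snd.continuousOn
      obtain ⟨a, ha, ha'⟩ := hS.exists_isMinOn hne continuous_snd.continuousOn
      refine ⟨(a.2, b.2), fun _ _ => ⟨?_, ?_⟩, fun z hz hzx => ⟨ha' ⟨hz, hzx⟩, hb' ⟨hz, hzx⟩⟩⟩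
      · have := ha.2
        simp only [Set.mem_ofPred_eq] at this
        rw [← this]; exact ha.1
      · have := hb.2
        simp only [Set.mem_ofPred_eq] at this
        rw [← this]; exact hb.1
    -- Outside `[0, p]` the column is empty, and any value serves.
    · refine ⟨(0, 0), fun h1 h2 => absurd ⟨h1, h2⟩ hx, fun z hz hzx => ?_⟩
      exact absurd (hzx ▸ h.hull_bounds hz) hx
  choose ab hab hab' using key
  exact ⟨fun x => (ab x).1, fun x => (ab x).2, ⟨fun x h1 h2 => (hab x h1 h2).2,
    fun z hz => (hab' z.1 z hz rfl).2⟩, fun x h1 h2 => (hab x h1 h2).1,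
    fun z hz => (hab' z.1 z hz rfl).1⟩

/-- Reflection in the first axis. -/
def reflect : (ℝ × ℝ) →ₗ[ℝ] (ℝ × ℝ) := LinearMap.prodMap LinearMap.id (-LinearMap.id)

theorem reflect_apply (z : ℝ × ℝ) : reflect z = (z.1, -z.2) := by simp [reflect]

/-- Through this reflection every fact about upper boundaries also covers `l`. -/
theorem IsColumns.lower {V : Set (ℝ × ℝ)} {p : ℕ} {l u : ℝ → ℝ} (hc : IsColumns V p l u) :
    IsUpper (reflect '' V) p (fun x => -l x) := by
  constructor
  · intro x h1 h2
    rw [← LinearMap.image_convexHull]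
    exact ⟨_, hc.mem x h1 h2, reflect_apply _⟩
  · intro z hz
    rw [← LinearMap.image_convexHull] at hz
    obtain ⟨w, hw, rfl⟩ := hz
    rw [reflect_apply]
    simpa using hc.le w hw

theorem IsColumns.trapezoids {V : Set (ℝ × ℝ)} {p : ℕ} {l u : ℝ → ℝ} (hc : IsColumns V p l u)
    (h : IsNormalized V p) :
    IntervalIntegrable l MeasureTheory.volume 0 p ∧
      (∫ x in (0 : ℝ)..p, l x) = trapezoid (fun k => l k) p ∧
      trapezoid (fun k => midRound (l k)) p = trapezoid (fun k => l k) p ∧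
      (∃ z : ℤ, l 0 = z) ∧ ∃ z : ℤ, l p = z := by
  have hfin : (reflect '' V).Finite := h.finite.image _
  have hsub : reflect '' V ⊆ lattice := by
    rintro _ ⟨v, hv, rfl⟩
    obtain ⟨z, rfl⟩ := h.sub hv
    exact ⟨(z.1, -z.2), by simp [reflect_apply]⟩
  have hb : ∀ v ∈ reflect '' V, 0 ≤ v.1 ∧ v.1 ≤ p := by
    rintro _ ⟨v, hv, rfl⟩
    simpa [reflect_apply] using h.bounds v hv
  have hl : ∃ v ∈ reflect '' V, v.1 = 0 := by
    obtain ⟨v, hv, h0⟩ := h.left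
    exact ⟨_, ⟨v, hv, rfl⟩, by simpa [reflect_apply] using h0⟩
  have hr : ∃ v ∈ reflect '' V, v.1 = p := by
    obtain ⟨v, hv, h0⟩ := h.right
    exact ⟨_, ⟨v, hv, rfl⟩, by simpa [reflect_apply] using h0⟩
  have neg_int : ∀ {t : ℝ}, (∃ z : ℤ, -t = z) → ∃ z : ℤ, t = z := by
    rintro t ⟨z, hz⟩
    exact ⟨-z, by push_cast; linarith⟩
  have trap_neg : ∀ f : ℕ → ℝ, trapezoid (fun k => -f k) p = -trapezoid f p := by
    intro f
    simp only [trapezoid, ← Finset.sum_neg_distrib]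
    exact Finset.sum_congr rfl fun k _ => by ring
  have round_neg : ∀ t, midRound (-t) = -midRound t := by
    intro t
    simp only [midRound, Int.floor_neg, Int.ceil_neg]; push_cast; ring
  obtain ⟨h1, h2, h3, h4⟩ := hc.lower.trapezoids hfin hsub hb hl hr
  refine ⟨by simpa [Function.comp_def, Pi.neg_def] using h1.neg, ?_, ?_,
    neg_int (hc.lower.zero_int hfin hsub hb hl), neg_int h4⟩
  · rw [intervalIntegral.integral_neg, trap_neg fun k => l k] at h2
    linarith
  · simp only [round_neg] at h3
    rw [trap_neg fun k => l k, trap_neg fun k => midRound (l k)] at h3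
    linarith

theorem IsUpper.chord_le {V : Set (ℝ × ℝ)} {p : ℕ} {u : ℝ → ℝ} (hu : IsUpper V p u)
    {a b x : ℝ} (ha : 0 ≤ a) (hb : b ≤ p) (hab : a < b) (h1 : a ≤ x) (h2 : x ≤ b) :
    u a + (x - a) * ((u b - u a) / (b - a)) ≤ u x :=
  hu.le _ (combo_mem (convex_convexHull ℝ V) (hu.mem a ha (hab.le.trans hb))
    (hu.mem b (ha.trans hab.le) hb) hab h1 h2)

theorem IsUpper.concaveOn {V : Set (ℝ × ℝ)} {p : ℕ} {u : ℝ → ℝ} (hu : IsUpper V p u) :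
    ConcaveOn ℝ (Set.Icc (0 : ℝ) p) u := by
  refine ⟨convex_Icc _ _, fun x hx y hy a b ha hb hab => ?_⟩
  have := hu.le _ (convex_convexHull ℝ V (hu.mem x hx.1 hx.2) (hu.mem y hy.1 hy.2) ha hb hab)
  simpa using this

theorem IsColumns.chord_ge {V : Set (ℝ × ℝ)} {p : ℕ} {l u : ℝ → ℝ} (hc : IsColumns V p l u)
    {a b x : ℝ} (ha : 0 ≤ a) (hb : b ≤ p) (hab : a < b) (h1 : a ≤ x) (h2 : x ≤ b) :
    l x ≤ l a + (x - a) * ((l b - l a) / (b - a)) := by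
  have := hc.lower.chord_le ha hb hab h1 h2
  rw [show -l b - -l a = -(l b - l a) by ring, neg_div] at this
  linarith

theorem IsColumns.le_upper {V : Set (ℝ × ℝ)} {p : ℕ} {l u : ℝ → ℝ} (hc : IsColumns V p l u)
    {x : ℝ} (h0 : 0 ≤ x) (h1 : x ≤ p) : l x ≤ u x := hc.upper.le _ (hc.mem x h0 h1)

theorem IsColumns.mem_iff {V : Set (ℝ × ℝ)} {p : ℕ} {l u : ℝ → ℝ} (hc : IsColumns V p l u)
    (h : IsNormalized V p) (x y : ℝ) :
    (x, y) ∈ convexHull ℝ V ↔ (0 ≤ x ∧ x ≤ p) ∧ l x ≤ y ∧ y ≤ u x := by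
  constructor
  · intro hz
    exact ⟨h.hull_bounds hz, hc.le _ hz, hc.upper.le _ hz⟩
  · rintro ⟨⟨h0, h1⟩, h2, h3⟩
    have hord : Set.OrdConnected {y | (x, y) ∈ convexHull ℝ V} := by
      refine Convex.ordConnected (𝕜 := ℝ) fun s hs t ht a b ha hb hab => ?_
      have := convex_convexHull ℝ V hs ht ha hb hab
      simp only [Set.mem_ofPred_eq]
      convert this using 1
      ext
      · simp [← add_mul, hab]
      · simp
    exact hord.out (hc.mem x h0 h1) (hc.upper.mem x h0 h1) ⟨h2, h3⟩

/-- Some column has positive length. Interpolating between it and an end column, whose length is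
nonnegative, keeps the length positive strictly inside. -/
theorem IsColumns.lt_upper {V : Set (ℝ × ℝ)} {p : ℕ} {l u : ℝ → ℝ} (hc : IsColumns V p l u)
    (h : IsNormalized V p) {x : ℝ} (hx0 : 0 < x) (hxp : x < p) : l x < u x := by
  obtain ⟨⟨x₀, y₀⟩, hz⟩ := h.interior_nonempty
  obtain ⟨h0, h1⟩ := h.interior_bounds hz
  obtain ⟨ε, hε, hb⟩ := exists_ball_mem hz
  have h2 := (hc.mem_iff h _ _).1 (hb 0 ε (by simpa using hε.le) (by rw [abs_of_pos hε]))
  have h3 := (hc.mem_iff h _ _).1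
    (hb 0 (-ε) (by simpa using hε.le) (by rw [abs_neg, abs_of_pos hε]))
  rw [add_zero] at h2 h3
  have h4 : 0 < u x₀ - l x₀ := by linarith [h2.2.2, h3.2.1]
  rcases le_or_gt x x₀ with hxx | hxx
  · have hu := hc.upper.chord_le le_rfl h1.le h0 hx0.le hxx
    have hl := hc.chord_ge le_rfl h1.le h0 hx0.le hxx
    have h5 := hc.le_upper le_rfl (by positivity : (0 : ℝ) ≤ p)
    have e : ∀ s t : ℝ, s + (x - 0) * ((t - s) / (x₀ - 0)) = (s * (x₀ - x) + t * x) / x₀ := by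
      intro s t; rw [sub_zero, sub_zero]; field_simp; ring
    rw [e] at hu hl
    have : 0 < ((u 0 * (x₀ - x) + u x₀ * x) / x₀) - (l 0 * (x₀ - x) + l x₀ * x) / x₀ := by
      rw [← sub_div]
      apply div_pos _ h0
      nlinarith [mul_pos h4 hx0, mul_nonneg (sub_nonneg.2 h5) (sub_nonneg.2 hxx)]
    linarith
  · have hu := hc.upper.chord_le h0.le le_rfl h1 hxx.le hxp.le
    have hl := hc.chord_ge h0.le le_rfl h1 hxx.le hxp.le
    have h5 := hc.le_upper (by positivity : (0 : ℝ) ≤ p) le_rfl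
    have hd : 0 < (p : ℝ) - x₀ := by linarith
    have e : ∀ s t : ℝ, s + (x - x₀) * ((t - s) / (p - x₀))
        = (s * (p - x) + t * (x - x₀)) / (p - x₀) := by
      intro s t; field_simp; ring
    rw [e] at hu hl
    have : 0 < ((u x₀ * (p - x) + u p * (x - x₀)) / (p - x₀))
        - (l x₀ * (p - x) + l p * (x - x₀)) / (p - x₀) := by
      rw [← sub_div]
      apply div_pos _ hd
      nlinarith [mul_pos h4 (sub_pos.2 hxp), mul_nonneg (sub_nonneg.2 h5) (sub_nonneg.2 hxx.le)]
    linarith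

theorem IsColumns.mem_interior_iff {V : Set (ℝ × ℝ)} {p : ℕ} {l u : ℝ → ℝ}
    (hc : IsColumns V p l u) (h : IsNormalized V p) (x y : ℝ) :
    (x, y) ∈ interior (convexHull ℝ V) ↔ (0 < x ∧ x < p) ∧ l x < y ∧ y < u x := by
  constructor
  · intro hz
    refine ⟨h.interior_bounds hz, ?_⟩
    obtain ⟨ε, hε, hb⟩ := exists_ball_mem hz
    have h2 := (hc.mem_iff h _ _).1 (hb 0 ε (by simpa using hε.le) (by rw [abs_of_pos hε]))
    have h3 := (hc.mem_iff h _ _).1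
      (hb 0 (-ε) (by simpa using hε.le) (by rw [abs_neg, abs_of_pos hε]))
    rw [add_zero] at h2 h3
    exact ⟨by linarith [h3.2.1], by linarith [h2.2.2]⟩
  · rintro ⟨hx, hy⟩
    -- Concave functions are continuous in the interior of their domain, so the strict inequalities
    -- are open conditions.
    have cont : ∀ f : ℝ → ℝ, ConcaveOn ℝ (Set.Icc (0 : ℝ) p) f → ContinuousAt f x := by
      intro f hf
      have := hf.continuousOn_interior
      rw [interior_Icc] at this
      exact this.continuousAt (Ioo_mem_nhds hx.1 hx.2)
    have cu := cont u hc.upper.concaveOn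
    have cl : ContinuousAt l x := by simpa [Pi.neg_def] using (cont _ hc.lower.concaveOn).neg
    rw [mem_interior_iff_mem_nhds]
    have hfst : ContinuousAt (Prod.fst : ℝ × ℝ → ℝ) (x, y) := continuousAt_fst
    have hsnd : ContinuousAt (Prod.snd : ℝ × ℝ → ℝ) (x, y) := continuousAt_snd
    have cu' : ContinuousAt (fun z : ℝ × ℝ => u z.1) (x, y) :=
      ContinuousAt.comp (g := u) (f := Prod.fst) cu hfst
    have cl' : ContinuousAt (fun z : ℝ × ℝ => l z.1) (x, y) :=
      ContinuousAt.comp (g := l) (f := Prod.fst) cl hfst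
    filter_upwards [hfst.eventually (Ioo_mem_nhds hx.1 hx.2),
      cl'.eventually_lt hsnd hy.1, hsnd.eventually_lt cu' hy.2] with z h1 h2 h3
    exact (hc.mem_iff h z.1 z.2).2 ⟨⟨h1.1.le, h1.2.le⟩, h2.le, h3.le⟩

/-! ### Area, column counts and Pick's theorem -/

theorem IsColumns.area_eq {V : Set (ℝ × ℝ)} {p : ℕ} {l u : ℝ → ℝ}
    (hc : IsColumns V p l u) (h : IsNormalized V p) :
    area (convexHull ℝ V) = trapezoid (fun k => u k) p - trapezoid (fun k => l k) p := by
  obtain ⟨hui, hu, -, -⟩ := hc.upper.trapezoids h.finite h.sub h.bounds h.left h.right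
  obtain ⟨hli, hl, -, -⟩ := hc.trapezoids h
  rw [← hu, ← hl, ← intervalIntegral.integral_sub hui hli]
  have hm : MeasurableSet (convexHull ℝ V) :=
    (h.finite.isCompact_convexHull (𝕜 := ℝ)).isClosed.measurableSet
  have hp : (0 : ℝ) ≤ p := by positivity
  have hslice : ∀ x : ℝ, MeasureTheory.volume (Prod.mk x ⁻¹' convexHull ℝ V)
      = (Set.Icc (0 : ℝ) p).indicator (fun x => ENNReal.ofReal (u x - l x)) x := by
    intro x
    by_cases hx : x ∈ Set.Icc (0 : ℝ) p
    · rw [Set.indicator_of_mem hx, ← Real.volume_Icc]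
      congr 1
      ext y
      rw [Set.mem_preimage, hc.mem_iff h]
      exact ⟨fun hh => hh.2, fun hh => ⟨hx, hh⟩⟩
    · rw [Set.indicator_of_notMem hx]
      have : Prod.mk x ⁻¹' convexHull ℝ V = ∅ := by
        ext y
        rw [Set.mem_preimage, hc.mem_iff h]
        exact ⟨fun hh => absurd hh.1 hx, fun hh => absurd hh (Set.notMem_empty _)⟩
      rw [this, MeasureTheory.measure_empty]
  rw [area, MeasureTheory.Measure.volume_eq_prod, MeasureTheory.Measure.prod_apply hm]
  simp only [hslice]
  rw [MeasureTheory.lintegral_indicator measurableSet_Icc, intervalIntegral.integral_of_le hp,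
    ← MeasureTheory.integral_Icc_eq_integral_Ioc,
    MeasureTheory.integral_eq_lintegral_of_nonneg_ae]
  · rw [MeasureTheory.ae_restrict_eq measurableSet_Icc]
    filter_upwards [Filter.mem_inf_of_right (Filter.mem_principal_self _)] with x hx
    exact sub_nonneg.2 (hc.le_upper hx.1 hx.2)
  · have := ((intervalIntegrable_iff_integrableOn_Icc_of_le hp).1 (hui.sub hli))
    exact this.aestronglyMeasurable

theorem trapezoid_succ (f : ℕ → ℝ) (q : ℕ) :
    trapezoid f (q + 1) = (f 0 + f (q + 1)) / 2 + ∑ j ∈ Finset.range q, f (j + 1) := by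
  induction q with
  | zero => simp [trapezoid]
  | succ q ih =>
    rw [trapezoid, Finset.sum_range_succ, ← trapezoid, ih, Finset.sum_range_succ]; ring

theorem ncard_column_points (s : Finset ℕ) (t : ℕ → Finset ℤ) (S : Set (ℝ × ℝ))
    (hS : ∀ z : ℝ × ℝ, z ∈ S ↔ ∃ k ∈ s, ∃ j ∈ t k, ((k : ℝ), (j : ℝ)) = z) :
    S.Finite ∧ S.ncard = ∑ k ∈ s, (t k).card := by
  have himg : S = (fun q : (_ : ℕ) × ℤ => ((q.1 : ℝ), (q.2 : ℝ))) '' (s.sigma t : Finset _) := by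
    ext z
    rw [hS]
    constructor
    · rintro ⟨k, hk, j, hj, rfl⟩
      exact ⟨⟨k, j⟩, by simp [hk, hj], rfl⟩
    · rintro ⟨⟨k, j⟩, hkj, rfl⟩
      simp only [Finset.coe_sigma, Set.mem_sigma_iff, Finset.mem_coe] at hkj
      exact ⟨k, hkj.1, j, hkj.2, rfl⟩
  have hinj : Function.Injective (fun q : (_ : ℕ) × ℤ => ((q.1 : ℝ), (q.2 : ℝ))) := by
    rintro ⟨a, b⟩ ⟨c, d⟩ hh
    simp only [Prod.mk.injEq, Nat.cast_inj, Int.cast_inj] at hh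
    obtain ⟨rfl, rfl⟩ := hh
    rfl
  constructor
  · rw [himg]; exact (Finset.finite_toSet _).image _
  · rw [himg, Set.ncard_image_of_injective _ hinj, Set.ncard_coe_finset, Finset.card_sigma]

theorem IsColumns.ncard_lattice {V : Set (ℝ × ℝ)} {p : ℕ} {l u : ℝ → ℝ}
    (hc : IsColumns V p l u) (h : IsNormalized V p) :
    (convexHull ℝ V ∩ lattice).Finite ∧ ((convexHull ℝ V ∩ lattice).ncard : ℝ)
      = ∑ k ∈ Finset.range (p + 1), ((⌊u k⌋ : ℝ) - ⌈l k⌉ + 1) := by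
  obtain ⟨hf, hn⟩ := ncard_column_points (Finset.range (p + 1))
    (fun k => Finset.Icc ⌈l k⌉ ⌊u k⌋) (convexHull ℝ V ∩ lattice) (by
      rintro ⟨x, y⟩
      constructor
      · rintro ⟨h1, ⟨⟨a, b⟩, hab⟩⟩
        simp only [Prod.mk.injEq] at hab
        obtain ⟨rfl, rfl⟩ := hab
        obtain ⟨⟨h2, h3⟩, h4, h5⟩ := (hc.mem_iff h _ _).1 h1
        obtain ⟨k, rfl⟩ := Int.eq_ofNat_of_zero_le (by exact_mod_cast h2 : 0 ≤ a)
        simp only [Int.cast_natCast] at h3 h4 h5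
        have h3' : k ≤ p := by exact_mod_cast h3
        exact ⟨k, Finset.mem_range.2 (by omega), b,
          Finset.mem_Icc.2 ⟨Int.ceil_le.2 h4, Int.le_floor.2 h5⟩, by simp⟩
      · rintro ⟨k, hk, j, hj, hh⟩
        rw [← hh]
        have hk' : k ≤ p := by have := Finset.mem_range.1 hk; omega
        obtain ⟨h1, h2⟩ := Finset.mem_Icc.1 hj
        exact ⟨(hc.mem_iff h _ _).2 ⟨⟨by positivity, by exact_mod_cast hk'⟩,
          Int.ceil_le.1 h1, Int.le_floor.1 h2⟩, ⟨(k, j), by simp⟩⟩)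
  refine ⟨hf, ?_⟩
  rw [hn]; push_cast
  refine Finset.sum_congr rfl fun k hk => ?_
  have hk' : k ≤ p := by have := Finset.mem_range.1 hk; omega
  have hlu := hc.le_upper (x := k) (by positivity) (by exact_mod_cast hk')
  -- A column may contain no lattice point. This bound keeps `⌊u⌋ + 1 - ⌈l⌉` nonnegative, so `toNat`
  -- does not truncate.
  have h1 : ⌈l k⌉ < ⌊u k⌋ + 2 := by
    have h2 := Int.ceil_lt_add_one (l k)
    have h3 := Int.lt_floor_add_one (u k)
    have : (⌈l k⌉ : ℝ) < ⌊u k⌋ + 2 := by linarith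
    exact_mod_cast this
  rw [Int.card_Icc]
  have h4 : ((⌊u k⌋ + 1 - ⌈l k⌉).toNat : ℤ) = ⌊u k⌋ + 1 - ⌈l k⌉ := Int.toNat_of_nonneg (by omega)
  have h5 : (((⌊u k⌋ + 1 - ⌈l k⌉).toNat : ℤ) : ℝ) = ⌊u k⌋ + 1 - ⌈l k⌉ := by
    rw [h4]; push_cast; ring
  rw [Int.cast_natCast] at h5
  rw [h5]; ring

theorem IsColumns.ncard_interior {V : Set (ℝ × ℝ)} {q : ℕ} {l u : ℝ → ℝ}
    (hc : IsColumns V (q + 1) l u) (h : IsNormalized V (q + 1)) :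
    (interiorPoints (convexHull ℝ V) : ℝ)
      = ∑ j ∈ Finset.range q, ((⌈u (j + 1 : ℕ)⌉ : ℝ) - ⌊l (j + 1 : ℕ)⌋ - 1) := by
  obtain ⟨-, hn⟩ := ncard_column_points ((Finset.range q).map (addRightEmbedding 1))
    (fun k => Finset.Ioo ⌊l k⌋ ⌈u k⌉) (interior (convexHull ℝ V) ∩ lattice) (by
      rintro ⟨x, y⟩
      constructor
      · rintro ⟨h1, ⟨⟨a, b⟩, hab⟩⟩
        simp only [Prod.mk.injEq] at hab
        obtain ⟨rfl, rfl⟩ := hab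
        obtain ⟨⟨h2, h3⟩, h4, h5⟩ := (hc.mem_interior_iff h _ _).1 h1
        obtain ⟨k, rfl⟩ := Int.eq_ofNat_of_zero_le (by exact_mod_cast h2.le : 0 ≤ a)
        simp only [Int.cast_natCast] at h2 h3 h4 h5
        have h2' : 0 < k := by exact_mod_cast h2
        have h3' : k < q + 1 := by exact_mod_cast h3
        refine ⟨k, Finset.mem_map.2 ⟨k - 1, Finset.mem_range.2 (by omega), ?_⟩, b,
          Finset.mem_Ioo.2 ⟨Int.floor_lt.2 h4, Int.lt_ceil.2 h5⟩, by simp⟩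
        simp; omega
      · rintro ⟨k, hk, j, hj, hh⟩
        rw [← hh]
        obtain ⟨k, hkq, rfl⟩ := Finset.mem_map.1 hk
        simp only [addRightEmbedding_apply] at *
        have hk' : k + 1 < q + 1 := by have := Finset.mem_range.1 hkq; omega
        obtain ⟨h1, h2⟩ := Finset.mem_Ioo.1 hj
        exact ⟨(hc.mem_interior_iff h _ _).2 ⟨⟨by positivity, by exact_mod_cast hk'⟩,
          Int.floor_lt.1 h1, Int.lt_ceil.1 h2⟩, ⟨((k + 1 : ℕ), j), by simp⟩⟩)
  rw [interiorPoints, hn, Nat.cast_sum, Finset.sum_map]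
  refine Finset.sum_congr rfl fun k hk => ?_
  have hk' : k + 1 < q + 1 := by have := Finset.mem_range.1 hk; omega
  have hlu := hc.lt_upper h (x := (k + 1 : ℕ)) (by positivity) (by exact_mod_cast hk')
  simp only [addRightEmbedding_apply]
  set x : ℝ := ((k + 1 : ℕ) : ℝ) with hx
  have h1 : ⌊l x⌋ < ⌈u x⌉ := by
    have : (⌊l x⌋ : ℝ) < ⌈u x⌉ := by linarith [Int.floor_le (l x), Int.le_ceil (u x)]
    exact_mod_cast this
  rw [Int.card_Ioo]
  have h4 : ((⌈u x⌉ - ⌊l x⌋ - 1).toNat : ℤ) = ⌈u x⌉ - ⌊l x⌋ - 1 := Int.toNat_of_nonneg (by omega)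
  have h5 : (((⌈u x⌉ - ⌊l x⌋ - 1).toNat : ℤ) : ℝ) = ⌈u x⌉ - ⌊l x⌋ - 1 := by
    rw [h4]; push_cast; ring
  rw [Int.cast_natCast] at h5
  rw [h5]

theorem boundaryPoints_add_interiorPoints {P : Set (ℝ × ℝ)} (hP : IsClosed P)
    (hf : (P ∩ lattice).Finite) :
    boundaryPoints P + interiorPoints P = (P ∩ lattice).ncard := by
  have hsub : interior P ∩ lattice ⊆ P ∩ lattice :=
    Set.inter_subset_inter_left _ interior_subset
  have : frontier P ∩ lattice = (P ∩ lattice) \ (interior P ∩ lattice) := by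
    rw [hP.frontier_eq]
    ext z
    simp only [Set.mem_inter_iff, Set.mem_sdiff]
    tauto
  rw [boundaryPoints, this, interiorPoints, Set.ncard_sdiff_add_ncard_of_subset hsub hf]

/-- The number of boundary points in terms of the columns. -/
theorem IsColumns.boundaryPoints_eq {V : Set (ℝ × ℝ)} {q : ℕ} {l u : ℝ → ℝ}
    (hc : IsColumns V (q + 1) l u) (h : IsNormalized V (q + 1)) :
    (boundaryPoints (convexHull ℝ V) : ℝ)
      = (u 0 - l 0) + (u (q + 1 : ℕ) - l (q + 1 : ℕ)) + 2 * (q + 1 : ℕ)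
        - ∑ j ∈ Finset.range q, (((⌈u (j + 1 : ℕ)⌉ : ℝ) - ⌊u (j + 1 : ℕ)⌋)
          + (⌈l (j + 1 : ℕ)⌉ - ⌊l (j + 1 : ℕ)⌋)) := by
  obtain ⟨hf, hn⟩ := hc.ncard_lattice h
  have hi := hc.ncard_interior h
  have hb := boundaryPoints_add_interiorPoints (h.finite.isCompact_convexHull (𝕜 := ℝ)).isClosed hf
  have hb' : (boundaryPoints (convexHull ℝ V) : ℝ) = (convexHull ℝ V ∩ lattice).ncard
      - interiorPoints (convexHull ℝ V) := by
    rw [← hb]; push_cast; ring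
  obtain ⟨-, -, -, z1, hz1⟩ := hc.upper.trapezoids h.finite h.sub h.bounds h.left h.right
  obtain ⟨z2, hz2⟩ := hc.upper.zero_int h.finite h.sub h.bounds h.left
  obtain ⟨-, -, -, ⟨z3, hz3⟩, z4, hz4⟩ := hc.trapezoids h
  rw [hb', hn, hi, Finset.sum_range_succ, Finset.sum_range_succ']
  simp only [Nat.cast_zero, hz1, hz2, hz3, hz4, Int.floor_intCast, Int.ceil_intCast]
  have hsum : ∑ j ∈ Finset.range q, ((⌊u (j + 1 : ℕ)⌋ : ℝ) - ⌈l (j + 1 : ℕ)⌉ + 1)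
      - ∑ j ∈ Finset.range q, ((⌈u (j + 1 : ℕ)⌉ : ℝ) - ⌊l (j + 1 : ℕ)⌋ - 1)
      + ∑ j ∈ Finset.range q, (((⌈u (j + 1 : ℕ)⌉ : ℝ) - ⌊u (j + 1 : ℕ)⌋)
          + (⌈l (j + 1 : ℕ)⌉ - ⌊l (j + 1 : ℕ)⌋)) = q * 2 := by
    rw [← Finset.sum_sub_distrib, ← Finset.sum_add_distrib,
      Finset.sum_congr rfl (g := fun _ => (2 : ℝ)) (fun _ _ => by ring)]
    simp
  push_cast at hsum ⊢
  linarith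

/-- Pick's theorem for normalized polygons. -/
theorem IsNormalized.pick {V : Set (ℝ × ℝ)} {p : ℕ} (h : IsNormalized V p) :
    2 * area (convexHull ℝ V)
      = 2 * interiorPoints (convexHull ℝ V) + boundaryPoints (convexHull ℝ V) - 2 := by
  obtain ⟨l, u, hc⟩ := h.exists_columns
  obtain ⟨q, rfl⟩ := Nat.exists_eq_add_of_le' h.pos
  obtain ⟨-, -, hu, z1, hz1⟩ := hc.upper.trapezoids h.finite h.sub h.bounds h.left h.right
  obtain ⟨z2, hz2⟩ := hc.upper.zero_int h.finite h.sub h.bounds h.left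
  obtain ⟨-, -, hl, ⟨z3, hz3⟩, z4, hz4⟩ := hc.trapezoids h
  rw [hc.area_eq h, ← hu, ← hl, ← trapezoid_sub, hc.ncard_interior h, hc.boundaryPoints_eq h,
    trapezoid_succ]
  simp only [Nat.cast_zero, hz1, hz2, hz3, hz4, midRound_int]
  -- Twice a rounded column height is twice its interior count, minus the rounding defects at its
  -- ends, plus 2. The same defects occur in the boundary formula.
  have hsum : 2 * ∑ j ∈ Finset.range q, (midRound (u (j + 1 : ℕ)) - midRound (l (j + 1 : ℕ)))
      = 2 * ∑ j ∈ Finset.range q, ((⌈u (j + 1 : ℕ)⌉ : ℝ) - ⌊l (j + 1 : ℕ)⌋ - 1)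
      - ∑ j ∈ Finset.range q, (((⌈u (j + 1 : ℕ)⌉ : ℝ) - ⌊u (j + 1 : ℕ)⌋)
          + (⌈l (j + 1 : ℕ)⌉ - ⌊l (j + 1 : ℕ)⌋)) + q * 2 := by
    rw [Finset.mul_sum, Finset.mul_sum, ← Finset.sum_sub_distrib,
      show (q : ℝ) * 2 = ∑ j ∈ Finset.range q, (2 : ℝ) by simp, ← Finset.sum_add_distrib]
    exact Finset.sum_congr rfl fun j _ => by simp only [midRound]; ring
  push_cast at hsum ⊢
  linarith

/-! ### Invariance under lattice equivalence -/

section Invariance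

variable {Φ : (ℝ × ℝ) ≃ᵃ[ℝ] (ℝ × ℝ)}

theorem image_interior_eq (Φ : (ℝ × ℝ) ≃ᵃ[ℝ] (ℝ × ℝ)) (P : Set (ℝ × ℝ)) :
    interior (Φ '' P) = Φ '' interior P :=
  ((AffineEquiv.toContinuousAffineEquiv Φ).toHomeomorph.image_interior P).symm

theorem image_frontier_eq (Φ : (ℝ × ℝ) ≃ᵃ[ℝ] (ℝ × ℝ)) (P : Set (ℝ × ℝ)) :
    frontier (Φ '' P) = Φ '' frontier P :=
  ((AffineEquiv.toContinuousAffineEquiv Φ).toHomeomorph.image_frontier P).symm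

theorem image_convexHull_eq (Φ : (ℝ × ℝ) ≃ᵃ[ℝ] (ℝ × ℝ)) (V : Set (ℝ × ℝ)) :
    Φ '' convexHull ℝ V = convexHull ℝ (Φ '' V) :=
  Φ.toAffineMap.image_convexHull V

theorem image_inter_lattice (hΦ : Φ '' lattice = lattice) (S : Set (ℝ × ℝ)) :
    Φ '' S ∩ lattice = Φ '' (S ∩ lattice) := by
  rw [Set.image_inter Φ.injective, hΦ]

theorem interiorPoints_image (hΦ : Φ '' lattice = lattice) (P : Set (ℝ × ℝ)) :
    interiorPoints (Φ '' P) = interiorPoints P := by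
  rw [interiorPoints, image_interior_eq, image_inter_lattice hΦ,
    Set.ncard_image_of_injective _ Φ.injective, interiorPoints]

theorem boundaryPoints_image (hΦ : Φ '' lattice = lattice) (P : Set (ℝ × ℝ)) :
    boundaryPoints (Φ '' P) = boundaryPoints P := by
  rw [boundaryPoints, image_frontier_eq, image_inter_lattice hΦ,
    Set.ncard_image_of_injective _ Φ.injective, boundaryPoints]

theorem IsConvexLatticePolygon.image (hΦ : Φ '' lattice = lattice) {P : Set (ℝ × ℝ)}
    (hP : IsConvexLatticePolygon P) : IsConvexLatticePolygon (Φ '' P) := by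
  obtain ⟨⟨V, hV, hL, rfl⟩, hi⟩ := hP
  refine ⟨⟨Φ '' V, hV.image _, ?_, image_convexHull_eq _ _⟩, ?_⟩
  · rw [← hΦ]; exact Set.image_mono hL
  · rw [image_interior_eq]; exact hi.image _

theorem peel_image (hΦ : Φ '' lattice = lattice) (P : Set (ℝ × ℝ)) :
    peel (Φ '' P) = Φ '' peel P := by
  rw [peel, image_interior_eq, image_inter_lattice hΦ, peel, image_convexHull_eq]

theorem peel_iterate_image (hΦ : Φ '' lattice = lattice) (P : Set (ℝ × ℝ)) (n : ℕ) :
    peel^[n] (Φ '' P) = Φ '' peel^[n] P := by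
  induction n with
  | zero => rfl
  | succ n ih => rw [Function.iterate_succ_apply', ih, peel_image hΦ, Function.iterate_succ_apply']

theorem skinCount_image (hΦ : Φ '' lattice = lattice) (P : Set (ℝ × ℝ)) :
    skinCount (Φ '' P) = skinCount P := by
  simp only [skinCount, peel_iterate_image hΦ, image_interior_eq, image_inter_lattice hΦ,
    Set.image_eq_empty]

theorem nucleus_image (hΦ : Φ '' lattice = lattice) (P : Set (ℝ × ℝ)) :
    nucleus (Φ '' P) = Φ '' nucleus P := by
  rw [nucleus, skinCount_image hΦ, peel_iterate_image hΦ, nucleus]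

theorem LatticeEquivalent.symm {P Q : Set (ℝ × ℝ)} (h : LatticeEquivalent P Q) :
    LatticeEquivalent Q P := by
  obtain ⟨Φ, hΦ, rfl⟩ := h
  have key : ∀ S : Set (ℝ × ℝ), Φ.symm '' (Φ '' S) = S := fun S => by
    rw [Set.image_image]; simp
  exact ⟨Φ.symm, by nth_rewrite 1 [← hΦ]; exact key _, key _⟩

theorem LatticeEquivalent.trans {P Q R : Set (ℝ × ℝ)} (h : LatticeEquivalent P Q)
    (h' : LatticeEquivalent Q R) : LatticeEquivalent P R := by
  obtain ⟨Φ, hΦ, rfl⟩ := h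
  obtain ⟨Ψ, hΨ, rfl⟩ := h'
  exact ⟨Φ.trans Ψ, by simp only [AffineEquiv.coe_trans, Set.image_comp, hΦ, hΨ],
    by simp only [AffineEquiv.coe_trans, Set.image_comp]⟩

theorem latticeEquivalent_image_iff (hΦ : Φ '' lattice = lattice) (P Q : Set (ℝ × ℝ)) :
    LatticeEquivalent (Φ '' P) Q ↔ LatticeEquivalent P Q :=
  ⟨fun h => LatticeEquivalent.trans ⟨Φ, hΦ, rfl⟩ h,
    fun h => (LatticeEquivalent.symm ⟨Φ, hΦ, rfl⟩).trans h⟩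

theorem level_image (hΦ : Φ '' lattice = lattice) (P : Set (ℝ × ℝ)) :
    level (Φ '' P) = level P := by
  rw [level, nucleus_image hΦ, skinCount_image hΦ, image_interior_eq,
    latticeEquivalent_image_iff hΦ, latticeEquivalent_image_iff hΦ, level]
  simp only [Set.image_eq_empty]

end Invariance

/-! ### Unimodular coordinates and lattice width -/

/-- The lattice equivalence given by an integral matrix of determinant one and an integral
translation. -/
noncomputable def unimodular (α β γ δ c d : ℤ) (h : α * δ - β * γ = 1) :
    (ℝ × ℝ) ≃ᵃ[ℝ] (ℝ × ℝ) where
  toFun z := (α * z.1 + β * z.2 + c, γ * z.1 + δ * z.2 + d)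
  invFun w := (δ * (w.1 - c) - β * (w.2 - d), α * (w.2 - d) - γ * (w.1 - c))
  left_inv z := by
    have h' : (α : ℝ) * δ - β * γ = 1 := by exact_mod_cast h
    ext
    · simp only; linear_combination z.1 * h'
    · simp only; linear_combination z.2 * h'
  right_inv w := by
    have h' : (α : ℝ) * δ - β * γ = 1 := by exact_mod_cast h
    ext
    · simp only; linear_combination (w.1 - c) * h'
    · simp only; linear_combination (w.2 - d) * h'
  linear :=
    { toFun := fun z => (α * z.1 + β * z.2, γ * z.1 + δ * z.2)
      invFun := fun w => (δ * w.1 - β * w.2, α * w.2 - γ * w.1)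
      map_add' := fun z w => by ext <;> simp <;> ring
      map_smul' := fun t z => by ext <;> simp <;> ring
      left_inv := fun z => by
        have h' : (α : ℝ) * δ - β * γ = 1 := by exact_mod_cast h
        ext
        · simp only; linear_combination z.1 * h'
        · simp only; linear_combination z.2 * h'
      right_inv := fun w => by
        have h' : (α : ℝ) * δ - β * γ = 1 := by exact_mod_cast h
        ext
        · simp only; linear_combination w.1 * h'
        · simp only; linear_combination w.2 * h' }
  map_vadd' z v := by ext <;> simp <;> ring

theorem unimodular_apply (α β γ δ c d : ℤ) (h : α * δ - β * γ = 1) (z : ℝ × ℝ) :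
    unimodular α β γ δ c d h z = (α * z.1 + β * z.2 + c, γ * z.1 + δ * z.2 + d) := rfl

theorem unimodular_image_lattice (α β γ δ c d : ℤ) (h : α * δ - β * γ = 1) :
    unimodular α β γ δ c d h '' lattice = lattice := by
  have h' : (α : ℝ) * δ - β * γ = 1 := by exact_mod_cast h
  ext w
  constructor
  · rintro ⟨_, ⟨⟨x, y⟩, rfl⟩, rfl⟩
    exact ⟨(α * x + β * y + c, γ * x + δ * y + d), by simp [unimodular_apply]⟩
  · rintro ⟨⟨x, y⟩, rfl⟩
    refine ⟨_, ⟨(δ * (x - c) - β * (y - d), α * (y - d) - γ * (x - c)), rfl⟩, ?_⟩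
    rw [unimodular_apply]
    ext
    · push_cast; linear_combination (x - c) * h'
    · push_cast; linear_combination (y - d) * h'

theorem convex_slab (α β c e : ℝ) :
    Convex ℝ {z : ℝ × ℝ | c ≤ α * z.1 + β * z.2 ∧ α * z.1 + β * z.2 ≤ e} := by
  have hl : IsLinearMap ℝ (fun z : ℝ × ℝ => α * z.1 + β * z.2) :=
    ⟨fun z w => by simp; ring, fun t z => by simp; ring⟩
  exact (convex_halfSpace_ge hl c).inter (convex_halfSpace_le hl e)

/-- Coordinates in which a given primitive functional is the first one, normalized to `[0, p]`. -/
theorem IsConvexLatticePolygon.exists_normalized {P : Set (ℝ × ℝ)}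
    (hP : IsConvexLatticePolygon P) (α β γ δ : ℤ) (h : α * δ - β * γ = 1) :
    ∃ (c : ℤ) (p : ℕ) (V : Set (ℝ × ℝ)), IsNormalized V p ∧
      unimodular α β γ δ c 0 h '' P = convexHull ℝ V := by
  obtain ⟨⟨V, hV, hL, rfl⟩, hi⟩ := hP
  have hne : V.Nonempty := by
    rw [← convexHull_nonempty_iff (𝕜 := ℝ)]
    exact hi.mono interior_subset
  obtain ⟨v, hv, hmin⟩ := Set.exists_min_image V (fun z => (α : ℝ) * z.1 + β * z.2) hV hne
  obtain ⟨w, hw, hmax⟩ := Set.exists_max_image V (fun z => (α : ℝ) * z.1 + β * z.2) hV hne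
  obtain ⟨⟨v1, v2⟩, rfl⟩ := hL hv
  obtain ⟨⟨w1, w2⟩, rfl⟩ := hL hw
  simp only at hmin hmax
  have hle : α * v1 + β * v2 ≤ α * w1 + β * w2 := by
    have := hmin _ hw
    simp only at this
    exact_mod_cast this
  obtain ⟨p, hp⟩ := Int.le.dest hle
  have hpr : (α : ℝ) * v1 + β * v2 + p = α * w1 + β * w2 := by exact_mod_cast hp
  refine ⟨-(α * v1 + β * v2), p, unimodular α β γ δ (-(α * v1 + β * v2)) 0 h '' V,
    ⟨hV.image _, ?_, ?_, ?_, ?_, ?_⟩, image_convexHull_eq _ _⟩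
  · exact (Set.image_mono hL).trans (unimodular_image_lattice ..).subset
  · rintro _ ⟨z, hz, rfl⟩
    have h1 := hmin z hz
    have h2 := hmax z hz
    simp only [unimodular_apply]
    push_cast
    constructor <;> linarith
  · refine ⟨_, ⟨_, hv, rfl⟩, ?_⟩
    simp [unimodular_apply]
  · refine ⟨_, ⟨_, hw, rfl⟩, ?_⟩
    simp only [unimodular_apply]
    push_cast; linarith
  · rw [← image_convexHull_eq, image_interior_eq]
    exact hi.image _

/-- Pick's theorem. -/
theorem IsConvexLatticePolygon.pick {P : Set (ℝ × ℝ)} (hP : IsConvexLatticePolygon P) :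
    2 * area P = 2 * interiorPoints P + boundaryPoints P - 2 := by
  -- With the identity matrix the change of coordinates is a translation, so translation invariance
  -- of area is enough here.
  obtain ⟨c, p, V, hV, hPV⟩ := hP.exists_normalized 1 0 0 1 (by norm_num)
  have hpick := hV.pick
  have himg : unimodular 1 0 0 1 c 0 (by norm_num) '' P = (fun z => ((c : ℝ), (0 : ℝ)) + z) '' P := by
    congr 1
    ext z <;> simp [unimodular_apply]; ring
  have harea : area (unimodular 1 0 0 1 c 0 (by norm_num) '' P) = area P := by
    rw [himg, area, Set.image_add_left, MeasureTheory.measure_preimage_add, area]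
  rw [← hPV, interiorPoints_image (unimodular_image_lattice _ _ _ _ _ _ _),
    boundaryPoints_image (unimodular_image_lattice _ _ _ _ _ _ _), harea] at hpick
  exact hpick

/-- `P` lies in the strip `c ≤ α x + β y ≤ c + w`. -/
def InStrip (P : Set (ℝ × ℝ)) (α β c w : ℤ) : Prop :=
  ∀ z ∈ P, (c : ℝ) ≤ α * z.1 + β * z.2 ∧ (α : ℝ) * z.1 + β * z.2 ≤ c + w

/-- Coordinates that realize the lattice width. -/
theorem IsConvexLatticePolygon.exists_width_normalized {P : Set (ℝ × ℝ)}
    (hP : IsConvexLatticePolygon P) :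
    ∃ (Φ : (ℝ × ℝ) ≃ᵃ[ℝ] (ℝ × ℝ)) (p : ℕ) (V : Set (ℝ × ℝ)), Φ '' lattice = lattice ∧
      IsNormalized V p ∧ Φ '' P = convexHull ℝ V ∧
      ∀ α β c w : ℤ, (α ≠ 0 ∨ β ≠ 0) → InStrip (convexHull ℝ V) α β c w → p ≤ w := by
  classical
  have strip_nonneg : ∀ {α β c w : ℤ}, InStrip P α β c w → 0 ≤ w := by
    intro α β c w h
    obtain ⟨z, hz⟩ := hP.2
    have := h z (interior_subset hz)
    have h3 : (0 : ℝ) ≤ w := by linarith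
    exact_mod_cast h3
  have hex : ∃ w : ℕ, ∃ α β c : ℤ, (α ≠ 0 ∨ β ≠ 0) ∧ InStrip P α β c w := by
    obtain ⟨c, p, V, hV, hPV⟩ := hP.exists_normalized 1 0 0 1 (by norm_num)
    refine ⟨p, 1, 0, -c, Or.inl one_ne_zero, fun z hz => ?_⟩
    have := hV.hull_bounds (hPV ▸ Set.mem_image_of_mem _ hz)
    simp only [unimodular_apply] at this
    push_cast at this ⊢
    constructor <;> linarith
  obtain ⟨α₀, β₀, c₀, hne, hstrip⟩ := Nat.find_spec hex
  have hg : 0 < Int.gcd α₀ β₀ := by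
    rw [Nat.pos_iff_ne_zero, Ne, Int.gcd_eq_zero_iff]
    tauto
  -- A functional of minimal width is divided by its content, which cannot increase the width.
  -- Bézout coefficients complete the primitive row to a matrix of determinant one.
  obtain ⟨α, β, hgcd, hα, hβ⟩ := Int.exists_gcd_one hg
  obtain ⟨a, b, hab⟩ := Int.isCoprime_iff_gcd_eq_one.2 hgcd
  have hdet : α * a - β * (-b) = 1 := by linarith
  obtain ⟨c, p, V, hV, hPV⟩ := hP.exists_normalized α β (-b) a hdet
  refine ⟨_, p, V, unimodular_image_lattice _ _ _ _ _ _ _, hV, hPV, ?_⟩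
  have hp : p ≤ Nat.find hex := by
    obtain ⟨v, hv, hv0⟩ := hV.left
    obtain ⟨w, hw, hwp⟩ := hV.right
    have hv' := subset_convexHull ℝ V hv
    have hw' := subset_convexHull ℝ V hw
    rw [← hPV] at hv' hw'
    obtain ⟨v, hv', rfl⟩ := hv'
    obtain ⟨w, hw', rfl⟩ := hw'
    have h1 := (hstrip v hv').1
    have h2 := (hstrip w hw').2
    simp only [unimodular_apply] at hv0 hwp
    set g := Int.gcd α₀ β₀ with hgdef
    have hαr : (α₀ : ℝ) = α * g := by rw [hα]; push_cast; rfl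
    have hβr : (β₀ : ℝ) = β * g := by rw [hβ]; push_cast; rfl
    rw [hαr, hβr] at h1 h2
    have hg1 : (1 : ℝ) ≤ g := by exact_mod_cast hg
    have h3 : (g : ℝ) * p ≤ (Nat.find hex : ℕ) := by
      have e1 : (α : ℝ) * g * v.1 + β * g * v.2 = g * (-c) := by
        linear_combination (g : ℝ) * hv0
      have e2 : (α : ℝ) * g * w.1 + β * g * w.2 = g * (p - c) := by
        linear_combination (g : ℝ) * hwp
      rw [e1] at h1
      rw [e2] at h2
      push_cast at h2
      linarith
    have h4 : (p : ℝ) ≤ (Nat.find hex : ℕ) := by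
      nlinarith [mul_nonneg (sub_nonneg.2 hg1) (Nat.cast_nonneg (α := ℝ) p)]
    exact_mod_cast h4
  intro α' β' c' w hne' hs
  -- A strip around the image pulls back to one of the same width around `P`, where minimality
  -- applies.
  have hs' : InStrip P (α' * α + β' * (-b)) (α' * β + β' * a) (c' - α' * c) w := by
    intro z hz
    have := hs _ (hPV ▸ Set.mem_image_of_mem _ hz)
    simp only [unimodular_apply] at this
    push_cast at this ⊢
    constructor <;> linarith
  have hne2 : (α' * α + β' * (-b)) ≠ 0 ∨ (α' * β + β' * a) ≠ 0 := by
    by_contra hcon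
    push Not at hcon
    obtain ⟨e1, e2⟩ := hcon
    have : α' = 0 := by linear_combination a * e1 + b * e2 - α' * hdet
    have : β' = 0 := by linear_combination α * e2 - β * e1 - β' * hdet
    tauto
  obtain ⟨n, rfl⟩ := Int.eq_ofNat_of_zero_le (strip_nonneg hs')
  have := Nat.find_min' hex ⟨_, _, _, hne2, hs'⟩
  exact_mod_cast hp.trans this

/-! ### Strips, peeling and the level -/

theorem mem_standardTriangle (x y : ℝ) :
    (x, y) ∈ standardTriangle ↔ 0 ≤ x ∧ 0 ≤ y ∧ x + y ≤ 1 := by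
  constructor
  · intro h
    have h1 := (convexHull_min (s := {((0 : ℝ), (0 : ℝ)), (1, 0), (0, 1)})
      (by rintro z (rfl | rfl | rfl) <;> norm_num) (convex_slab 1 0 0 1)) h
    have h2 := (convexHull_min (s := {((0 : ℝ), (0 : ℝ)), (1, 0), (0, 1)})
      (by rintro z (rfl | rfl | rfl) <;> norm_num) (convex_slab 0 1 0 1)) h
    have h3 := (convexHull_min (s := {((0 : ℝ), (0 : ℝ)), (1, 0), (0, 1)})
      (by rintro z (rfl | rfl | rfl) <;> norm_num) (convex_slab 1 1 0 1)) h
    simp only [Set.mem_ofPred_eq, one_mul, zero_mul, add_zero, zero_add] at h1 h2 h3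
    exact ⟨h1.1, h2.1, h3.2⟩
  · rintro ⟨h1, h2, h3⟩
    have hc : Convex ℝ standardTriangle := convex_convexHull ℝ _
    have m0 : ((0 : ℝ), (0 : ℝ)) ∈ standardTriangle := subset_convexHull ℝ _ (by simp)
    have m1 : ((1 : ℝ), (0 : ℝ)) ∈ standardTriangle := subset_convexHull ℝ _ (by simp)
    have m2 : ((0 : ℝ), (1 : ℝ)) ∈ standardTriangle := subset_convexHull ℝ _ (by simp)
    rcases h1.eq_or_lt with h | h
    · have := hc m0 m2 (a := 1 - y) (b := y) (by linarith) h2 (by ring)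
      simpa [← h] using this
    · have hs : 0 < x + y := by linarith
      have h4 := hc m1 m2 (a := x / (x + y)) (b := y / (x + y)) (by positivity) (by positivity)
        (by field_simp)
      have := hc m0 h4 (a := 1 - (x + y)) (b := x + y) (by linarith) hs.le (by ring)
      convert this using 1
      ext <;> simp <;> field_simp

theorem mem_smul_standardTriangle {k : ℝ} (hk : 0 < k) (x y : ℝ) :
    (x, y) ∈ k • standardTriangle ↔ 0 ≤ x ∧ 0 ≤ y ∧ x + y ≤ k := by
  rw [Set.mem_smul_set_iff_inv_smul_mem₀ hk.ne', Prod.smul_mk, mem_standardTriangle, smul_eq_mul,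
    smul_eq_mul, ← mul_add, inv_mul_le_iff₀ hk, mul_one]
  have hi := inv_pos.2 hk
  rw [mul_nonneg_iff_of_pos_left hi, mul_nonneg_iff_of_pos_left hi]

theorem InStrip.strict {P : Set (ℝ × ℝ)} {α β c w : ℤ} (h : InStrip P α β c w)
    (hne : α ≠ 0 ∨ β ≠ 0) {z : ℝ × ℝ} (hz : z ∈ interior P) :
    (c : ℝ) < α * z.1 + β * z.2 ∧ (α : ℝ) * z.1 + β * z.2 < c + w := by
  obtain ⟨x, y⟩ := z
  obtain ⟨ε, hε, hb⟩ := exists_ball_mem hz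
  have key : ∀ t : ℝ, t ≠ 0 → (∀ σ : ℝ, |σ| = ε → (c : ℝ) ≤ α * x + β * y + σ * t ∧
      (α : ℝ) * x + β * y + σ * t ≤ c + w) →
      (c : ℝ) < α * x + β * y ∧ (α : ℝ) * x + β * y < c + w := by
    intro t ht hh
    have h1 := hh ε (abs_of_pos hε)
    have h2 := hh (-ε) (by rw [abs_neg, abs_of_pos hε])
    rcases lt_or_gt_of_ne ht with h | h
    · have := mul_neg_of_pos_of_neg hε h
      constructor <;> linarith
    · have := mul_pos hε h
      constructor <;> linarith
  rcases hne with h0 | h0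
  · refine key α (by exact_mod_cast h0) fun σ hσ => ?_
    have := h _ (hb σ 0 hσ.le (by simpa using hε.le))
    simp only at this
    constructor <;> linarith
  · refine key β (by exact_mod_cast h0) fun σ hσ => ?_
    have := h _ (hb 0 σ (by simpa using hε.le) hσ.le)
    simp only at this
    constructor <;> linarith

/-- At interior lattice points the functional is an integer strictly between the bounds, so each
bound improves by one. -/
theorem InStrip.peel {P : Set (ℝ × ℝ)} {α β c w : ℤ} (h : InStrip P α β c w)
    (hne : α ≠ 0 ∨ β ≠ 0) : InStrip (peel P) α β (c + 1) (w - 2) := by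
  have hsub : interior P ∩ lattice ⊆ {z : ℝ × ℝ | ((c + 1 : ℤ) : ℝ) ≤ α * z.1 + β * z.2 ∧
      (α : ℝ) * z.1 + β * z.2 ≤ (c + 1 : ℤ) + (w - 2 : ℤ)} := by
    rintro _ ⟨hz, ⟨⟨a, b⟩, rfl⟩⟩
    obtain ⟨h1, h2⟩ := h.strict hne hz
    simp only at h1 h2
    have h1' : c < α * a + β * b := by exact_mod_cast h1
    have h2' : α * a + β * b < c + w := by exact_mod_cast h2
    have h3 : c + 1 ≤ α * a + β * b := by omega
    have h4 : α * a + β * b ≤ (c + 1) + (w - 2) := by omega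
    simp only [Set.mem_ofPred_eq]
    exact ⟨by exact_mod_cast h3, by exact_mod_cast h4⟩
  exact fun z hz => convexHull_min hsub (convex_slab _ _ _ _) hz

theorem InStrip.peel_iterate {P : Set (ℝ × ℝ)} {α β c w : ℤ} (h : InStrip P α β c w)
    (hne : α ≠ 0 ∨ β ≠ 0) (n : ℕ) :
    InStrip (LatticePolygon.peel^[n] P) α β (c + n) (w - 2 * n) := by
  induction n with
  | zero => simpa using h
  | succ n ih =>
    rw [Function.iterate_succ_apply']
    have := ih.peel hne
    convert this using 1 <;> push_cast <;> ring

/-- The functional is nonconstant along one of the two edges at the image of the origin. Each of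
these is twice a lattice vector, so the change along it is a nonzero even integer. -/
theorem two_le_of_inStrip_of_equivalent_two {P : Set (ℝ × ℝ)} {α β c w : ℤ}
    (hP : LatticeEquivalent P ((2 : ℝ) • standardTriangle)) (hne : α ≠ 0 ∨ β ≠ 0)
    (h : InStrip P α β c w) : 2 ≤ w := by
  obtain ⟨Ψ, hΨ, rfl⟩ := hP.symm
  set H : (ℝ × ℝ) → ℝ := fun z => α * z.1 + β * z.2 with hH
  have hadd : ∀ v w, H (v + w) = H v + H w := fun v w => by simp [hH]; ring
  have hsmul : ∀ (t : ℝ) v, H (t • v) = t * H v := fun t v => by simp [hH]; ring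
  have hlin : ∀ v, Ψ v = Ψ.linear v + Ψ 0 := fun v => by
    have := Ψ.map_vadd 0 v
    simpa using this
  have hint : ∀ v ∈ lattice, ∃ n : ℤ, H (Ψ v) = n := by
    intro v hv
    have : Ψ v ∈ lattice := hΨ ▸ Set.mem_image_of_mem _ hv
    obtain ⟨⟨a, b⟩, hab⟩ := this
    rw [← hab]
    exact ⟨α * a + β * b, by simp [hH]⟩
  have key : ∀ e : ℝ × ℝ, e ∈ lattice → (2 : ℝ) • e ∈ (2 : ℝ) • standardTriangle →
      H (Ψ.linear e) ≠ 0 → 2 ≤ w := by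
    intro e he h2e h0
    obtain ⟨n, hn⟩ := hint e he
    obtain ⟨m, hm⟩ := hint 0 ⟨(0, 0), by simp⟩
    have hz : (0 : ℝ × ℝ) ∈ (2 : ℝ) • standardTriangle :=
      (mem_smul_standardTriangle two_pos 0 0).2 (by norm_num)
    have h1 := h _ (Set.mem_image_of_mem _ hz)
    have h2 := h _ (Set.mem_image_of_mem _ h2e)
    change (c : ℝ) ≤ H (Ψ 0) ∧ H (Ψ 0) ≤ c + w at h1
    change (c : ℝ) ≤ H (Ψ ((2 : ℝ) • e)) ∧ H (Ψ ((2 : ℝ) • e)) ≤ c + w at h2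
    rw [hlin, hadd] at hn
    rw [hlin ((2 : ℝ) • e), hadd, map_smul, hsmul] at h2
    have hd : H (Ψ.linear e) = (n - m : ℤ) := by push_cast; linarith
    rw [hd] at h2 h0
    rw [hm] at h1 h2
    have h0' : n - m ≠ 0 := by exact_mod_cast h0
    have a1 : c ≤ m := by exact_mod_cast h1.1
    have a2 : m ≤ c + w := by exact_mod_cast h1.2
    have a3 : c ≤ 2 * (n - m) + m := by exact_mod_cast h2.1
    have a4 : 2 * (n - m) + m ≤ c + w := by exact_mod_cast h2.2
    omega
  by_cases h1 : H (Ψ.linear (1, 0)) = 0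
  · by_cases h2 : H (Ψ.linear (0, 1)) = 0
    · exfalso
      have hall : ∀ v, H v = 0 := by
        intro v
        obtain ⟨⟨x, y⟩, rfl⟩ := Ψ.linear.surjective v
        have : ((x, y) : ℝ × ℝ) = x • ((1 : ℝ), (0 : ℝ)) + y • ((0 : ℝ), (1 : ℝ)) := by
          ext <;> simp
        rw [this, map_add, map_smul, map_smul, hadd, hsmul, hsmul, h1, h2]; ring
      have e1 := hall (1, 0)
      have e2 := hall (0, 1)
      simp only [hH, mul_one, mul_zero, add_zero, zero_add, Int.cast_eq_zero] at e1 e2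
      tauto
    · refine key (0, 1) ⟨(0, 1), by simp⟩ ?_ h2
      rw [Prod.smul_mk, mem_smul_standardTriangle two_pos]; norm_num
  · refine key (1, 0) ⟨(1, 0), by simp⟩ ?_ h1
    rw [Prod.smul_mk, mem_smul_standardTriangle two_pos]; norm_num

/-- The level is at most half the lattice width. -/
theorem two_mul_level_le {P : Set (ℝ × ℝ)} (hP : (interior P).Nonempty) (h1 : 1 ≤ level P)
    {α β c w : ℤ} (hne : α ≠ 0 ∨ β ≠ 0) (h : InStrip P α β c w) : 2 * level P ≤ w := by
  -- Without peeling the nucleus is the two-dimensional `P`, whose level is below 1. A positive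
  -- count also guarantees that the nucleus is nonempty, which the degenerate case needs.
  have hn : skinCount P ≠ 0 := by
    intro h0
    have hnuc : nucleus P = P := by rw [nucleus, h0]; rfl
    rw [level, hnuc, if_neg hP.ne_empty, h0] at h1
    split_ifs at h1 <;> norm_num at h1
  obtain ⟨m, hm⟩ := Nat.exists_eq_succ_of_ne_zero hn
  have hnuc : nucleus P = peel (peel^[m] P) := by
    rw [nucleus, hm, Nat.succ_eq_add_one, Function.iterate_succ_apply']
  have hmem : (interior (peel^[m] P) ∩ lattice).Nonempty := by
    have : m ∉ {n : ℕ | interior (peel^[n] P) ∩ lattice = ∅} :=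
      Nat.notMem_of_lt_sInf (by rw [skinCount] at hm; omega)
    exact Set.nonempty_iff_ne_empty.2 this
  have hstrip : InStrip (nucleus P) α β (c + skinCount P) (w - 2 * skinCount P) :=
    h.peel_iterate hne _
  have hnonempty : (nucleus P).Nonempty := by
    rw [hnuc, peel]
    exact hmem.mono (subset_convexHull ℝ _)
  have hdeg : 2 * (skinCount P : ℝ) ≤ w := by
    obtain ⟨z, hz⟩ := hnonempty
    have := hstrip z hz
    push_cast at this
    linarith
  have hfull : interior (nucleus P) ≠ ∅ → 2 * (skinCount P : ℝ) + 1 ≤ w := by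
    intro hi
    obtain ⟨z, hz⟩ := Set.nonempty_iff_ne_empty.2 hi
    have := hstrip.strict hne hz
    have h3 : (0 : ℝ) < ((w - 2 * skinCount P : ℤ) : ℝ) := by linarith
    have h4 : 0 < w - 2 * (skinCount P : ℤ) := by exact_mod_cast h3
    have h5 : 2 * (skinCount P : ℤ) + 1 ≤ w := by omega
    exact_mod_cast h5
  rw [level]
  split_ifs with hi hD h2D
  · exact hdeg
  · linarith [hfull hi]
  · have := two_le_of_inStrip_of_equivalent_two h2D hne hstrip
    have h5 : 2 * (skinCount P : ℤ) + 2 ≤ w := by omega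
    have h6 : 2 * (skinCount P : ℝ) + 2 ≤ w := by exact_mod_cast h5
    linarith
  · linarith [hfull hi]

/-! ### Scott's estimates for boundary points and area -/

/-- Each nonintegral end of an inner column loses a boundary point, so equality makes all of these
ends integral. -/
theorem IsColumns.boundaryPoints_le {V : Set (ℝ × ℝ)} {p : ℕ} {l u : ℝ → ℝ}
    (hc : IsColumns V p l u) (h : IsNormalized V p) :
    (boundaryPoints (convexHull ℝ V) : ℝ) ≤ (u 0 - l 0) + (u p - l p) + 2 * p ∧
      ((boundaryPoints (convexHull ℝ V) : ℝ) = (u 0 - l 0) + (u p - l p) + 2 * p →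
        ∀ k : ℕ, 0 < k → k < p → (∃ z : ℤ, u k = z) ∧ ∃ z : ℤ, l k = z) := by
  obtain ⟨q, rfl⟩ := Nat.exists_eq_add_of_le' h.pos
  rw [hc.boundaryPoints_eq h]
  have hd : ∀ t : ℝ, (0 : ℝ) ≤ (⌈t⌉ : ℝ) - ⌊t⌋ := fun t => by
    linarith [Int.floor_le t, Int.le_ceil t]
  have hnn : ∀ j ∈ Finset.range q, (0 : ℝ) ≤ ((⌈u (j + 1 : ℕ)⌉ : ℝ) - ⌊u (j + 1 : ℕ)⌋)
      + (⌈l (j + 1 : ℕ)⌉ - ⌊l (j + 1 : ℕ)⌋) := fun j _ => add_nonneg (hd _) (hd _)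
  refine ⟨by linarith [Finset.sum_nonneg hnn], fun he k hk hkq => ?_⟩
  have h0 := (Finset.sum_eq_zero_iff_of_nonneg hnn).1 (by linarith) (k - 1)
    (Finset.mem_range.2 (by omega))
  rw [Nat.sub_add_cancel hk] at h0
  have hint : ∀ t : ℝ, (⌈t⌉ : ℝ) - ⌊t⌋ = 0 → ∃ z : ℤ, t = z := fun t ht =>
    ⟨⌊t⌋, by linarith [Int.floor_le t, Int.le_ceil t]⟩
  exact ⟨hint _ (by linarith [hd (u k), hd (l k)]), hint _ (by linarith [hd (u k), hd (l k)])⟩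

theorem IsUpper.symm_sum_le {V : Set (ℝ × ℝ)} {p : ℕ} {u : ℝ → ℝ} (hu : IsUpper V p u)
    (a d : ℕ) (had : a + d ≤ p) (k : ℕ) (hk : k ≤ d) :
    u (a : ℝ) + u ((a + d : ℕ) : ℝ) ≤ u ((a + k : ℕ) : ℝ) + u ((a + (d - k) : ℕ) : ℝ) := by
  rcases Nat.eq_zero_or_pos d with rfl | hd
  · obtain rfl : k = 0 := by omega
    simp
  have hdr : (0 : ℝ) < d := by exact_mod_cast hd
  have hkr : (k : ℝ) ≤ d := by exact_mod_cast hk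
  have hb : ((a + d : ℕ) : ℝ) ≤ p := by exact_mod_cast had
  have h1 := hu.chord_le (a := a) (b := (a + d : ℕ)) (x := (a + k : ℕ)) (by positivity) hb
    (by push_cast; linarith) (by push_cast; linarith [Nat.cast_nonneg (α := ℝ) k])
    (by push_cast; linarith)
  have h2 := hu.chord_le (a := a) (b := (a + d : ℕ)) (x := (a + (d - k) : ℕ)) (by positivity) hb
    (by push_cast; linarith) (by push_cast [Nat.cast_sub hk]; linarith)
    (by push_cast [Nat.cast_sub hk]; linarith [Nat.cast_nonneg (α := ℝ) k])
  set U := u ((a + d : ℕ) : ℝ)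
  have e : ∀ t : ℝ, u a + t * ((U - u a) / (((a + d : ℕ) : ℝ) - a)) = u a + t / d * (U - u a) := by
    intro t
    rw [show ((a + d : ℕ) : ℝ) - a = d by push_cast; ring]
    field_simp
  rw [e] at h1 h2
  have e2 : (((a + k : ℕ) : ℝ) - a) / d + (((a + (d - k) : ℕ) : ℝ) - a) / d = 1 := by
    push_cast [Nat.cast_sub hk]
    field_simp
    ring
  have := congrArg (fun s => s * (U - u a)) e2
  linarith

theorem IsUpper.le_trapezoid {V : Set (ℝ × ℝ)} {p : ℕ} {u : ℝ → ℝ} (hu : IsUpper V p u)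
    (a d : ℕ) (had : a + d ≤ p) :
    d * (u a + u (a + d : ℕ)) / 2 ≤ trapezoid (fun j => u (a + j : ℕ)) d :=
  le_trapezoid_of_symm (hu.symm_sum_le a d had)

/-- The region below a concave function contains the region below any three of its points. -/
theorem IsUpper.le_two_mul_trapezoid {V : Set (ℝ × ℝ)} {p : ℕ} {u : ℝ → ℝ} (hu : IsUpper V p u)
    (r : ℕ) (hr : r ≤ p) :
    r * u 0 + (p - r) * u p + p * u r ≤ 2 * trapezoid (fun k => u k) p := by
  obtain ⟨d, rfl⟩ := Nat.exists_eq_add_of_le hr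
  have h1 := hu.le_trapezoid 0 r (by omega)
  have h2 := hu.le_trapezoid r d le_rfl
  rw [trapezoid_add]
  simp only [zero_add, Nat.cast_zero] at h1
  push_cast at *
  linarith

/-- The hull contains the trapezoid whose parallel sides are the two end columns. -/
theorem IsColumns.mul_le_two_mul_area {V : Set (ℝ × ℝ)} {p : ℕ} {l u : ℝ → ℝ}
    (hc : IsColumns V p l u) (h : IsNormalized V p) :
    p * ((u 0 - l 0) + (u p - l p)) ≤ 2 * area (convexHull ℝ V) := by
  have h1 := hc.upper.le_two_mul_trapezoid p le_rfl
  have h2 := hc.lower.le_two_mul_trapezoid p le_rfl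
  have e : trapezoid (fun k => -l k) p = -trapezoid (fun k => l k) p := by
    have := trapezoid_sub (fun _ => 0) (fun k => l k) p
    simpa [trapezoid] using this
  rw [e] at h2
  rw [hc.area_eq h]
  linarith

/-- Scott's estimate: shear so that the end columns nearly face each other. -/
theorem IsColumns.mul_le_four_mul_area {V : Set (ℝ × ℝ)} {p : ℕ} {l u : ℝ → ℝ}
    (hc : IsColumns V p l u) (h : IsNormalized V p)
    (hw : ∀ α β c w : ℤ, (α ≠ 0 ∨ β ≠ 0) → InStrip (convexHull ℝ V) α β c w → p ≤ w)
    (hs : (u 0 - l 0) + (u p - l p) ≤ p) :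
    p * (p + ((u 0 - l 0) + (u p - l p))) ≤ 4 * area (convexHull ℝ V) := by
  have hp : (0 : ℝ) < p := by exact_mod_cast h.pos
  have h0 := hc.le_upper le_rfl hp.le
  have hpp := hc.le_upper hp.le le_rfl
  set s := (u 0 - l 0) + (u p - l p) with hsdef
  -- The shear `y ↦ y + m x` brings the midpoints of the end columns within `p / 2` of each other in
  -- height.
  obtain ⟨m, hm⟩ : ∃ m : ℤ, |(u p + l p - u 0 - l 0) / 2 + m * p| ≤ p / 2 := by
    refine ⟨-round ((u p + l p - u 0 - l 0) / 2 / p), ?_⟩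
    have hr := abs_sub_round ((u p + l p - u 0 - l 0) / 2 / p)
    have := mul_le_mul_of_nonneg_right hr hp.le
    rw [← abs_of_pos hp, ← abs_mul, abs_of_pos hp, sub_mul, div_mul_cancel₀ _ hp.ne'] at this
    push_cast
    rw [neg_mul, ← sub_eq_add_neg]
    linarith
  -- The possible rises from left to right end column fill an interval of length `s` around the rise
  -- of the midpoints. `D` is its point closest to `-(m * p)`.
  obtain ⟨D, hD1, hD2, hD3⟩ : ∃ D : ℝ, l p - u 0 ≤ D ∧ D ≤ u p - l 0 ∧
      |D + m * p| ≤ (p - s) / 2 := by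
    obtain ⟨hm1, hm2⟩ := abs_le.1 hm
    rcases lt_or_ge (s / 2) ((u p + l p - u 0 - l 0) / 2 + m * p) with hlt | hge
    · exact ⟨l p - u 0, le_rfl, by linarith, abs_le.2 ⟨by linarith, by linarith⟩⟩
    · rcases lt_or_ge ((u p + l p - u 0 - l 0) / 2 + m * p) (-(s / 2)) with hlt' | hge'
      · exact ⟨u p - l 0, by linarith, le_rfl, abs_le.2 ⟨by linarith, by linarith⟩⟩
      · refine ⟨-(m * p), by linarith, by linarith, ?_⟩
        rw [neg_add_cancel, abs_zero]; linarith
  obtain ⟨yA, yB, hA1, hA2, hB1, hB2, hAB⟩ : ∃ yA yB : ℝ, l 0 ≤ yA ∧ yA ≤ u 0 ∧ l p ≤ yB ∧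
      yB ≤ u p ∧ yB - yA = D := by
    rcases le_total D (l p - l 0) with hle | hle
    · exact ⟨l p - D, l p, by linarith, by linarith, le_rfl, hpp, by ring⟩
    · exact ⟨l 0, D + l 0, le_rfl, h0, by linarith, by linarith, by ring⟩
  obtain ⟨R, hR, hmax⟩ := Set.exists_max_image V (fun z => (m : ℝ) * z.1 + z.2) h.finite
    (h.left.imp fun _ hv => hv.1)
  obtain ⟨L, hL, hmin⟩ := Set.exists_min_image V (fun z => (m : ℝ) * z.1 + z.2) h.finite
    (h.left.imp fun _ hv => hv.1)
  have coords : ∀ v ∈ V, ∃ (k : ℕ) (j : ℤ), k ≤ p ∧ v = ((k : ℝ), (j : ℝ)) := by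
    intro v hv
    obtain ⟨⟨a, b⟩, rfl⟩ := h.sub hv
    obtain ⟨h1, h2⟩ := h.bounds _ hv
    simp only at h1 h2
    obtain ⟨k, rfl⟩ := Int.eq_ofNat_of_zero_le (by exact_mod_cast h1 : 0 ≤ a)
    simp only [Int.cast_natCast] at h2
    exact ⟨k, b, by exact_mod_cast h2, by simp⟩
  obtain ⟨r, yR, hrp, rfl⟩ := coords R hR
  obtain ⟨r', yL, hrp', rfl⟩ := coords L hL
  simp only at hmax hmin
  -- Minimality of `p`, applied to the sheared height `m x + y`, separates its maximum at `(r, yR)`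
  -- and minimum at `(r', yL)`.
  have hwidth : (p : ℤ) ≤ (m * r + yR) - (m * r' + yL) := by
    refine hw m 1 (m * r' + yL) _ (Or.inr one_ne_zero) fun z hz => ?_
    refine convexHull_min (fun v hv => ?_) (convex_slab _ _ _ _) hz
    have h1 := hmax v hv
    have h2 := hmin v hv
    simp only [Set.mem_ofPred_eq]
    push_cast
    constructor <;> linarith
  have hwr : (p : ℝ) ≤ (m * r + yR) - (m * r' + yL) := by exact_mod_cast hwidth
  have hRu := hc.upper.le _ (subset_convexHull ℝ V hR)
  have hLl := hc.le _ (subset_convexHull ℝ V hL)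
  simp only at hRu hLl
  -- With `A = (0, yA)` and `B = (p, yB)`, the paths from `A` to `B` through the maximum and through
  -- the minimum bound the area: `2a ≥ p (yR - yL) - (r - r') (yB - yA)`.
  have t1 := hc.upper.le_two_mul_trapezoid r hrp
  have t2 := hc.lower.le_two_mul_trapezoid r' hrp'
  have e : trapezoid (fun k => -l k) p = -trapezoid (fun k => l k) p := by
    have := trapezoid_sub (fun _ => 0) (fun k => l k) p
    simpa [trapezoid] using this
  rw [e] at t2
  rw [hc.area_eq h]
  have r0 : (0 : ℝ) ≤ r := by positivity
  have r0' : (0 : ℝ) ≤ r' := by positivity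
  have rp : (r : ℝ) ≤ p := by exact_mod_cast hrp
  have rp' : (r' : ℝ) ≤ p := by exact_mod_cast hrp'
  have a1 := mul_le_mul_of_nonneg_left hA2 r0
  have a2 := mul_le_mul_of_nonneg_left hB2 (sub_nonneg.2 rp)
  have a3 := mul_le_mul_of_nonneg_left hRu hp.le
  have b1 := mul_le_mul_of_nonneg_left hA1 r0'
  have b2 := mul_le_mul_of_nonneg_left hB1 (sub_nonneg.2 rp')
  have b3 := mul_le_mul_of_nonneg_left hLl hp.le
  have hcross : ((r : ℝ) - r') * (yB - yA + m * p) ≤ p * ((p - s) / 2) := by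
    have h1 : |((r : ℝ) - r') * (yB - yA + m * p)| ≤ p * ((p - s) / 2) := by
      rw [abs_mul, hAB]
      exact mul_le_mul (abs_le.2 ⟨by linarith, by linarith⟩) hD3 (abs_nonneg _) hp.le
    exact (le_abs_self _).trans h1
  have hww := mul_le_mul_of_nonneg_left hwr hp.le
  linarith

/-! ### The equality case -/

theorem IsUpper.le_line_of_nat {V : Set (ℝ × ℝ)} {p : ℕ} {u : ℝ → ℝ} (hu : IsUpper V p u)
    (hL : V ⊆ lattice) (h0 : ∀ v ∈ V, 0 ≤ v.1 ∧ v.1 ≤ p) {A C : ℝ}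
    (h : ∀ k : ℕ, k ≤ p → u k ≤ A + C * k) {x : ℝ} (hx0 : 0 ≤ x) (hxp : x ≤ p) :
    u x ≤ A + C * x := by
  refine below_line (fun v hv => ?_) _ (hu.mem x hx0 hxp)
  have hle := hu.le v (subset_convexHull ℝ V hv)
  obtain ⟨⟨a, b⟩, rfl⟩ := hL hv
  obtain ⟨h1, h2⟩ := h0 _ hv
  simp only at h1 h2
  obtain ⟨k, rfl⟩ := Int.eq_ofNat_of_zero_le (by exact_mod_cast h1 : 0 ≤ a)
  simp only [Int.cast_natCast] at h2
  have := h k (by exact_mod_cast h2)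
  simp only [Int.cast_natCast] at hle ⊢
  linarith

/-- Concavity puts `u` above its chord, and the symmetric sums leave no slack at integers. Since the
vertices lie over integers, the chord bounds the whole hull. -/
theorem IsUpper.affine_of_symm {V : Set (ℝ × ℝ)} {p : ℕ} {u : ℝ → ℝ} (hu : IsUpper V p u)
    (hp : 0 < p) (hL : V ⊆ lattice) (h0 : ∀ v ∈ V, 0 ≤ v.1 ∧ v.1 ≤ p)
    (h : ∀ k : ℕ, k < p → u k + u (p - k : ℕ) = u 0 + u p) {x : ℝ} (hx0 : 0 ≤ x) (hxp : x ≤ p) :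
    u x = u 0 + (u p - u 0) / p * x := by
  have hpr : (0 : ℝ) < p := by exact_mod_cast hp
  have hchord : ∀ x : ℝ, 0 ≤ x → x ≤ p → u 0 + (u p - u 0) / p * x ≤ u x := by
    intro x h1 h2
    have := hu.chord_le le_rfl le_rfl hpr h1 h2
    rw [sub_zero, sub_zero] at this
    linarith
  refine le_antisymm (hu.le_line_of_nat hL h0 (fun k hk => ?_) hx0 hxp) (hchord x hx0 hxp)
  rcases hk.lt_or_eq with hk' | rfl
  · have h1 := h k hk'
    have hkr : (k : ℝ) ≤ p := by exact_mod_cast hk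
    have h2 := hchord (p - k : ℕ) (by positivity)
      (by rw [Nat.cast_sub hk]; linarith [Nat.cast_nonneg (α := ℝ) k])
    rw [Nat.cast_sub hk] at h1 h2
    have h3 : (u p - u 0) / p * p = u p - u 0 := by field_simp
    rw [mul_sub, h3] at h2
    linarith
  · have h3 : (u k - u 0) / k * k = u k - u 0 := by field_simp
    rw [h3]; linarith

theorem image_eq_of_mem_iff {P Q : Set (ℝ × ℝ)} (Φ : (ℝ × ℝ) ≃ᵃ[ℝ] (ℝ × ℝ))
    (h : ∀ z, Φ z ∈ Q ↔ z ∈ P) : Φ '' P = Q := by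
  ext w
  constructor
  · rintro ⟨z, hz, rfl⟩; exact (h z).2 hz
  · intro hw
    obtain ⟨z, rfl⟩ := Φ.surjective w
    exact ⟨z, (h z).1 hw, rfl⟩

/-- The equality case of Scott's estimates. -/
theorem IsColumns.equivalent_of_equality {V : Set (ℝ × ℝ)} {p : ℕ} {l u : ℝ → ℝ}
    (hc : IsColumns V p l u) (h : IsNormalized V p) (hp2 : 2 ≤ p)
    (hw : ∀ α β c w : ℤ, (α ≠ 0 ∨ β ≠ 0) → InStrip (convexHull ℝ V) α β c w → p ≤ w)
    (hs : (u 0 - l 0) + (u p - l p) = p)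
    (hb : (boundaryPoints (convexHull ℝ V) : ℝ) = 3 * p)
    (ha : 2 * area (convexHull ℝ V) = p * p) :
    LatticeEquivalent (convexHull ℝ V) ((p : ℝ) • standardTriangle) := by
  have hp : (0 : ℝ) < p := by exact_mod_cast h.pos
  -- Integral column ends at abscissa 1 make the slopes of the affine boundaries integral. This is
  -- where `2 ≤ p` enters.
  have hint := (hc.boundaryPoints_le h).2 (by linarith) 1 one_pos (by omega)
  obtain ⟨⟨z1, hz1⟩, z2, hz2⟩ := hint
  obtain ⟨zu, hzu⟩ := hc.upper.zero_int h.finite h.sub h.bounds h.left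
  obtain ⟨-, -, -, ⟨zl, hzl⟩, -⟩ := hc.trapezoids h
  have hsu := hc.upper.symm_sum_le 0 p (by omega)
  have hsl := hc.lower.symm_sum_le 0 p (by omega)
  simp only [zero_add, Nat.cast_zero] at hsu hsl
  have heq := symm_of_trapezoid_eq (f := fun k => u k - l k) (d := p) (S := p)
    (fun k hk => by linarith [hsu k hk, hsl k hk])
    (by rw [trapezoid_sub, ← hc.area_eq h]; linarith)
  have huaff : ∀ x : ℝ, 0 ≤ x → x ≤ p → u x = u 0 + (u p - u 0) / p * x := fun x h1 h2 =>
    hc.upper.affine_of_symm h.pos h.sub h.bounds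
      (fun k hk => by linarith [heq k hk, hsu k hk.le, hsl k hk.le]) h1 h2
  have hrsub : reflect '' V ⊆ lattice := by
    rintro _ ⟨v, hv, rfl⟩
    obtain ⟨z, rfl⟩ := h.sub hv
    exact ⟨(z.1, -z.2), by simp [reflect_apply]⟩
  have hrb : ∀ v ∈ reflect '' V, 0 ≤ v.1 ∧ v.1 ≤ p := by
    rintro _ ⟨v, hv, rfl⟩
    simpa [reflect_apply] using h.bounds v hv
  have hlaff : ∀ x : ℝ, 0 ≤ x → x ≤ p → l x = l 0 + (l p - l 0) / p * x := by
    intro x h1 h2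
    have := hc.lower.affine_of_symm h.pos hrsub hrb
      (fun k hk => by linarith [heq k hk, hsu k hk.le, hsl k hk.le]) h1 h2
    rw [show -l p - -l 0 = -(l p - l 0) by ring, neg_div] at this
    linarith
  have hp1 : (1 : ℝ) ≤ p := by exact_mod_cast h.pos
  have hu1 := huaff 1 zero_le_one hp1
  have hl1 := hlaff 1 zero_le_one hp1
  rw [Nat.cast_one] at hz1 hz2
  rw [mul_one, hz1, hzu] at hu1
  rw [mul_one, hz2, hzl] at hl1
  obtain ⟨μ, hμ⟩ : ∃ μ : ℤ, (u p - zu) / p = (μ : ℝ) := ⟨z1 - zu, by push_cast; linarith⟩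
  obtain ⟨ν, hν⟩ : ∃ ν : ℤ, (l p - zl) / p = (ν : ℝ) := ⟨z2 - zl, by push_cast; linarith⟩
  rw [hzu, hμ] at huaff
  rw [hzl, hν] at hlaff
  have hmem : ∀ x y : ℝ, (x, y) ∈ convexHull ℝ V ↔
      (0 ≤ x ∧ x ≤ p) ∧ zl + ν * x ≤ y ∧ y ≤ zu + μ * x := by
    intro x y
    rw [hc.mem_iff h]
    constructor
    · rintro ⟨hx, hy⟩
      rw [huaff x hx.1 hx.2, hlaff x hx.1 hx.2] at hy
      exact ⟨hx, hy⟩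
    · rintro ⟨hx, hy⟩
      rw [huaff x hx.1 hx.2, hlaff x hx.1 hx.2]
      exact ⟨hx, hy⟩
  have hup := huaff p hp.le le_rfl
  have hlp := hlaff p hp.le le_rfl
  have h0 := hc.le_upper le_rfl hp.le
  have hpp := hc.le_upper hp.le le_rfl
  rw [hzu, hzl] at h0 hs
  rw [hup, hlp] at hpp hs
  -- This is `s = p` in terms of the slopes. Nonnegativity of the two end columns then confines `μ -
  -- ν` to `-1`, `0`, `1`.
  have k1 : 2 * ((zu : ℝ) - zl) = p * (1 - ((μ - ν : ℤ) : ℝ)) := by push_cast; linarith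
  have k2 : (μ - ν : ℤ) ≤ 1 := by
    have : (0 : ℝ) ≤ 1 - ((μ - ν : ℤ) : ℝ) := by
      by_contra hcon
      push Not at hcon
      nlinarith [mul_neg_of_pos_of_neg hp hcon]
    have : ((μ - ν : ℤ) : ℝ) ≤ 1 := by linarith
    exact_mod_cast this
  have k3 : -1 ≤ (μ - ν : ℤ) := by
    have : (0 : ℝ) ≤ 1 + ((μ - ν : ℤ) : ℝ) := by
      by_contra hcon
      push Not at hcon
      have := mul_neg_of_pos_of_neg hp hcon
      push_cast at *
      linarith
    have : (-1 : ℝ) ≤ ((μ - ν : ℤ) : ℝ) := by linarith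
    exact_mod_cast this
  obtain hk | hk | hk : μ - ν = -1 ∨ μ - ν = 0 ∨ μ - ν = 1 := by omega
  · rw [hk] at k1
    push_cast at k1
    have hμν : (μ : ℝ) = ν - 1 := by
      have : μ = ν - 1 := by omega
      rw [this]; push_cast; ring
    refine ⟨unimodular 1 0 (-ν) 1 0 (-zl) (by ring), unimodular_image_lattice .., ?_⟩
    apply image_eq_of_mem_iff
    rintro ⟨x, y⟩
    rw [unimodular_apply, mem_smul_standardTriangle hp, hmem, hμν]
    push_cast
    constructor
    · rintro ⟨a1, a2, a3⟩
      refine ⟨⟨?_, ?_⟩, ?_, ?_⟩ <;> linarith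
    · rintro ⟨⟨a1, a2⟩, a3, a4⟩
      refine ⟨?_, ?_, ?_⟩ <;> linarith
  -- Equal slopes give a parallelogram lying in a strip of width `p / 2`, against minimality of `p`.
  · exfalso
    have hμν : (μ : ℝ) = ν := by
      have : μ = ν := by omega
      rw [this]
    have := hw (-ν) 1 zl (zu - zl) (Or.inr one_ne_zero) (by
      rintro ⟨x, y⟩ hz
      obtain ⟨-, a1, a2⟩ := (hmem x y).1 hz
      rw [hμν] at a2
      push_cast
      constructor <;> linarith)
    have h' : (p : ℝ) ≤ zu - zl := by exact_mod_cast this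
    rw [hk] at k1
    push_cast at k1
    linarith
  · rw [hk] at k1
    push_cast at k1
    have hμν : (μ : ℝ) = ν + 1 := by
      have : μ = ν + 1 := by omega
      rw [this]; push_cast; ring
    -- Here the left column is the apex and the right one has length `p`; in the first case the
    -- roles are reversed.
    refine ⟨unimodular (-ν) 1 (-1) 0 (-zl) p (by ring), unimodular_image_lattice .., ?_⟩
    apply image_eq_of_mem_iff
    rintro ⟨x, y⟩
    rw [unimodular_apply, mem_smul_standardTriangle hp, hmem, hμν]
    push_cast
    constructor
    · rintro ⟨a1, a2, a3⟩
      refine ⟨⟨?_, ?_⟩, ?_, ?_⟩ <;> linarith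
    · rintro ⟨⟨a1, a2⟩, a3, a4⟩
      refine ⟨?_, ?_, ?_⟩ <;> linarith

/-! ### From the estimates to the level inequality -/

/-- With `b` and `a` replaced by their bounds, the slack `2a + 9L² - 2Lb` is `(p - 3L)² + (s - p)(p
- 2L)` if `p ≤ s`. If `s ≤ p` it is `(p - 3L)² + (p - s)(4L - p)/2`, which serves for `p ≤ 4L`. It
also equals `(p - 4L)²/2 + s(p - 4L)/2 + L²`, which is positive for `p > 4L`. Equality thus forces
`p = 3L`, and then `s = p`. -/
theorem scott_real_inequality {L p s b a : ℝ} (hL : 0 < L) (hp : 2 * L ≤ p) (hs : 0 ≤ s)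
    (hb : b ≤ s + 2 * p) (ha : p * s ≤ 2 * a) (ha' : s ≤ p → p * (p + s) ≤ 4 * a) :
    2 * L * b ≤ 2 * a + 9 * L ^ 2 ∧
      (2 * L * b = 2 * a + 9 * L ^ 2 → p = 3 * L ∧ s = p ∧ b = 3 * p ∧ 2 * a = p * p) := by
  have hb' : 2 * L * b ≤ 2 * L * (s + 2 * p) := mul_le_mul_of_nonneg_left hb (by linarith)
  have hsq : 0 ≤ (p - 3 * L) ^ 2 := sq_nonneg _
  have conclude : s = p → (p - 3 * L) ^ 2 ≤ 0 → 2 * L * b = 2 * a + 9 * L ^ 2 →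
      p = 3 * L ∧ s = p ∧ b = 3 * p ∧ 2 * a = p * p := by
    intro h1 h2 h3
    have h4 : p - 3 * L = 0 := pow_eq_zero_iff two_ne_zero |>.1 (le_antisymm h2 hsq)
    have h5 : p = 3 * L := by linarith
    subst h1
    subst h5
    have h6 : b ≤ 9 * L := by linarith
    have h7 : 2 * L * b ≤ 2 * L * (9 * L) := mul_le_mul_of_nonneg_left h6 (by linarith)
    have h8 : 2 * L * b = 2 * L * (9 * L) := by nlinarith
    have h9 : b = 9 * L := mul_left_cancel₀ (by positivity) h8
    exact ⟨rfl, rfl, by linarith, by nlinarith⟩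
  rcases le_total s p with hsp | hsp
  · have h4 := ha' hsp
    rcases le_or_gt p (4 * L) with hp4 | hp4
    · have h5 : 0 ≤ (p - s) * (4 * L - p) :=
        mul_nonneg (by linarith) (by linarith)
      refine ⟨by nlinarith, fun he => ?_⟩
      have h6 : (p - 3 * L) ^ 2 ≤ 0 := by nlinarith
      have h7 : p - 3 * L = 0 := pow_eq_zero_iff two_ne_zero |>.1 (le_antisymm h6 hsq)
      have h8 : (p - s) * (4 * L - p) ≤ 0 := by nlinarith
      have h9 : 4 * L - p = L := by linarith
      rw [h9] at h8
      have h10 : s = p := by nlinarith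
      exact conclude h10 h6 he
    · have h5 : 0 ≤ s * (p - 4 * L) := mul_nonneg hs (by linarith)
      have h6 : 2 * L * b < 2 * a + 9 * L ^ 2 := by nlinarith [sq_nonneg (p - 4 * L)]
      exact ⟨h6.le, fun he => absurd he h6.ne⟩
  · have h5 : 0 ≤ (s - p) * (p - 2 * L) := mul_nonneg (by linarith) (by linarith)
    refine ⟨by nlinarith, fun he => ?_⟩
    have h6 : (p - 3 * L) ^ 2 ≤ 0 := by nlinarith
    have h7 : p - 3 * L = 0 := pow_eq_zero_iff two_ne_zero |>.1 (le_antisymm h6 hsq)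
    have h8 : (s - p) * (p - 2 * L) ≤ 0 := by nlinarith
    have h9 : p - 2 * L = L := by linarith
    rw [h9] at h8
    exact conclude (by nlinarith) h6 he

/-- The inequality between area, boundary points and level, and its equality case. -/
theorem IsConvexLatticePolygon.level_inequality {P : Set (ℝ × ℝ)}
    (hP : IsConvexLatticePolygon P) (h1 : 1 ≤ level P) :
    2 * level P * boundaryPoints P ≤ 2 * area P + 9 * level P ^ 2 ∧
      (2 * level P * boundaryPoints P = 2 * area P + 9 * level P ^ 2 →
        IsMultipleOfStandardTriangle P) := by
  obtain ⟨Φ, p, V, hΦ, hV, hPV, hw⟩ := hP.exists_width_normalized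
  -- Area is preserved because Pick's formula expresses it by invariant counts.
  have harea : area P = area (convexHull ℝ V) := by
    have e1 := hP.pick
    have e2 := (hP.image hΦ).pick
    rw [boundaryPoints_image hΦ, interiorPoints_image hΦ, hPV] at e2
    linarith
  have hlev := level_image hΦ P
  have hbd := boundaryPoints_image hΦ P
  rw [hPV] at hlev hbd
  obtain ⟨l, u, hc⟩ := hV.exists_columns
  have hp : (0 : ℝ) < p := by exact_mod_cast hV.pos
  have hstrip : InStrip (convexHull ℝ V) 1 0 0 p := fun z hz => by
    have := hV.hull_bounds hz
    push_cast
    constructor <;> linarith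
  have hle := two_mul_level_le hV.interior_nonempty (hlev ▸ h1) (Or.inl one_ne_zero) hstrip
  rw [hlev] at hle
  have hs : 0 ≤ (u 0 - l 0) + (u p - l p) :=
    add_nonneg (sub_nonneg.2 (hc.le_upper le_rfl hp.le)) (sub_nonneg.2 (hc.le_upper hp.le le_rfl))
  rw [harea, ← hbd]
  have key := scott_real_inequality (L := level P) (by linarith) (by exact_mod_cast hle) hs
    (hc.boundaryPoints_le hV).1 (hc.mul_le_two_mul_area hV) (hc.mul_le_four_mul_area hV hw)
  refine ⟨key.1, fun he => ?_⟩
  obtain ⟨k1, k2, k3, k4⟩ := key.2 he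
  refine ⟨p, hV.pos, ?_⟩
  have hp2 : 2 ≤ p := by
    have : (2 : ℝ) ≤ p := by linarith
    exact_mod_cast this
  have := hc.equivalent_of_equality hV hp2 hw k2 k3 k4
  rw [← hPV] at this
  exact (latticeEquivalent_image_iff hΦ _ _).1 this

/-! ### Multiples of the standard triangle -/

/-- The triangle cut out by `x ≥ j`, `y ≥ j` and `x + y ≤ e`. -/
def cornerTriangle (j e : ℤ) : Set (ℝ × ℝ) :=
  {z : ℝ × ℝ | (j : ℝ) ≤ z.1 ∧ (j : ℝ) ≤ z.2 ∧ z.1 + z.2 ≤ e}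

theorem convex_cornerTriangle (j e : ℤ) : Convex ℝ (cornerTriangle j e) := by
  have h1 : Convex ℝ {z : ℝ × ℝ | (j : ℝ) ≤ z.1} :=
    convex_halfSpace_ge (f := fun z : ℝ × ℝ => z.1) ⟨by simp, by simp⟩ _
  have h2 : Convex ℝ {z : ℝ × ℝ | (j : ℝ) ≤ z.2} :=
    convex_halfSpace_ge (f := fun z : ℝ × ℝ => z.2) ⟨by simp, by simp⟩ _
  have h3 : Convex ℝ {z : ℝ × ℝ | z.1 + z.2 ≤ e} :=
    convex_halfSpace_le (f := fun z : ℝ × ℝ => z.1 + z.2)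
      ⟨fun z w => by simp; ring, fun t z => by simp; ring⟩ _
  exact h1.inter (h2.inter h3)

theorem interior_cornerTriangle (j e : ℤ) :
    interior (cornerTriangle j e) = {z : ℝ × ℝ | (j : ℝ) < z.1 ∧ (j : ℝ) < z.2 ∧ z.1 + z.2 < (e : ℝ)} := by
  apply Set.Subset.antisymm
  · rintro ⟨x, y⟩ hz
    obtain ⟨ε, hε, hb⟩ := exists_ball_mem hz
    have h1 := hb (-ε) (-ε) (by rw [abs_neg, abs_of_pos hε]) (by rw [abs_neg, abs_of_pos hε])
    have h2 := hb ε ε (by rw [abs_of_pos hε]) (by rw [abs_of_pos hε])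
    simp only [cornerTriangle, Set.mem_ofPred_eq] at h1 h2 ⊢
    refine ⟨?_, ?_, ?_⟩ <;> linarith
  · apply interior_maximal
    · rintro z ⟨h1, h2, h3⟩
      exact ⟨h1.le, h2.le, h3.le⟩
    · exact (isOpen_lt continuous_const continuous_fst).inter
        ((isOpen_lt continuous_const continuous_snd).inter
          (isOpen_lt (continuous_fst.add continuous_snd) continuous_const))

theorem translate_smul_standardTriangle (j : ℤ) (r : ℕ) (hr : 0 < r) :
    unimodular 1 0 0 1 j j (by norm_num) '' ((r : ℝ) • standardTriangle)
      = cornerTriangle j (r + 2 * j) := by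
  ext ⟨x, y⟩
  have hr' : (0 : ℝ) < r := by exact_mod_cast hr
  constructor
  · rintro ⟨⟨a, b⟩, hz, hxy⟩
    rw [mem_smul_standardTriangle hr'] at hz
    rw [← hxy, unimodular_apply]
    simp only [cornerTriangle, Set.mem_ofPred_eq]
    push_cast
    refine ⟨?_, ?_, ?_⟩ <;> linarith
  · intro h
    simp only [cornerTriangle, Set.mem_ofPred_eq] at h
    push_cast at h
    refine ⟨(x - j, y - j), ?_, ?_⟩
    · rw [mem_smul_standardTriangle hr']
      refine ⟨?_, ?_, ?_⟩ <;> linarith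
    · simp [unimodular_apply]

theorem smul_standardTriangle_eq (k : ℝ) :
    k • standardTriangle = convexHull ℝ {((0 : ℝ), (0 : ℝ)), (k, 0), (0, k)} := by
  rw [standardTriangle, ← convexHull_smul]
  congr 1
  simp [Set.smul_set_insert]

theorem cornerTriangle_lattice {j e : ℤ} {x y : ℤ} :
    ((x : ℝ), (y : ℝ)) ∈ interior (cornerTriangle j e) ↔ j + 1 ≤ x ∧ j + 1 ≤ y ∧ x + y ≤ e - 1 := by
  rw [interior_cornerTriangle]
  simp only [Set.mem_ofPred_eq]
  norm_cast
  omega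

/-- All three sides move inward by one, so the side length `e - 2 * j` drops by 3. The hypothesis
says that it is at least 3. -/
theorem peel_cornerTriangle {j e : ℤ} (h : 2 * (j + 1) ≤ e - 1) :
    peel (cornerTriangle j e) = cornerTriangle (j + 1) (e - 1) := by
  apply Set.Subset.antisymm
  · refine convexHull_min ?_ (convex_cornerTriangle _ _)
    rintro _ ⟨hz, ⟨⟨x, y⟩, rfl⟩⟩
    obtain ⟨h1, h2, h3⟩ := cornerTriangle_lattice.1 hz
    simp only [cornerTriangle, Set.mem_ofPred_eq]
    exact_mod_cast And.intro h1 (And.intro h2 h3)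
  · have hpt : ∀ x y : ℤ, j + 1 ≤ x → j + 1 ≤ y → x + y ≤ e - 1 →
        ((x : ℝ), (y : ℝ)) ∈ interior (cornerTriangle j e) ∩ lattice := fun x y h1 h2 h3 =>
      ⟨cornerTriangle_lattice.2 ⟨h1, h2, h3⟩, ⟨(x, y), rfl⟩⟩
    obtain ⟨r, hr⟩ := Int.le.dest h
    have he : e - 1 = r + 2 * (j + 1) := by omega
    -- `r` is the new side length. For `r = 0` the triangle is a point; otherwise its three vertices
    -- are interior lattice points of the old one.
    rcases Nat.eq_zero_or_pos r with rfl | hrpos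
    · rintro ⟨x, y⟩ ⟨h1, h2, h3⟩
      simp only at h1 h2 h3
      rw [he] at h3
      push_cast at h1 h2 h3
      have hx : x = ((j + 1 : ℤ) : ℝ) := by push_cast; linarith
      have hy : y = ((j + 1 : ℤ) : ℝ) := by push_cast; linarith
      rw [hx, hy]
      exact subset_convexHull ℝ _ (hpt _ _ le_rfl le_rfl (by omega))
    · rw [he, ← translate_smul_standardTriangle _ _ hrpos, smul_standardTriangle_eq,
        image_convexHull_eq, peel]
      apply convexHull_mono
      rintro _ ⟨z, hz, rfl⟩
      rcases hz with rfl | rfl | rfl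
      · have := hpt (j + 1) (j + 1) le_rfl le_rfl (by omega)
        simpa [unimodular_apply] using this
      · have := hpt (r + (j + 1)) (j + 1) (by omega) le_rfl (by omega)
        simpa [unimodular_apply] using this
      · have := hpt (j + 1) (r + (j + 1)) le_rfl (by omega) (by omega)
        simpa [unimodular_apply] using this

theorem peel_iterate_cornerTriangle (k n : ℕ) (h : 3 * n ≤ k) :
    peel^[n] (cornerTriangle 0 k) = cornerTriangle n (k - n) := by
  induction n with
  | zero => simp
  | succ n ih =>
    rw [Function.iterate_succ_apply', ih (by omega), peel_cornerTriangle (by omega)]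
    congr 1
    push_cast; ring

theorem skinCount_cornerTriangle (k : ℕ) : skinCount (cornerTriangle 0 k) = k / 3 := by
  have hmem : k / 3 ∈ {n : ℕ | interior (peel^[n] (cornerTriangle 0 k)) ∩ lattice = ∅} := by
    simp only [Set.mem_ofPred_eq]
    rw [peel_iterate_cornerTriangle k (k / 3) (by omega), Set.eq_empty_iff_forall_notMem]
    rintro _ ⟨hz, ⟨⟨x, y⟩, rfl⟩⟩
    have := cornerTriangle_lattice.1 hz
    omega
  refine le_antisymm (Nat.sInf_le hmem) (le_csInf ⟨_, hmem⟩ fun n hn => ?_)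
  by_contra hlt
  push Not at hlt
  simp only [Set.mem_ofPred_eq] at hn
  rw [peel_iterate_cornerTriangle k n (by omega)] at hn
  have : (((n + 1 : ℤ) : ℝ), ((n + 1 : ℤ) : ℝ)) ∈
      interior (cornerTriangle n (k - n)) ∩ lattice :=
    ⟨cornerTriangle_lattice.2 ⟨le_rfl, le_rfl, by omega⟩, ⟨(n + 1, n + 1), rfl⟩⟩
  rw [hn] at this
  exact this

/-- The definition of the level tests for `Δ` before `2Δ`, so a nucleus `2Δ` must be shown to fail
the first test. The widths 1 and 2 tell them apart. -/
theorem not_standardTriangle_equivalent_two :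
    ¬ LatticeEquivalent standardTriangle ((2 : ℝ) • standardTriangle) := by
  intro h
  have : (2 : ℤ) ≤ 1 := two_le_of_inStrip_of_equivalent_two (α := 1) (β := 0) (c := 0) h
    (Or.inl one_ne_zero) (by
      rintro ⟨x, y⟩ hz
      obtain ⟨h1, h2, h3⟩ := (mem_standardTriangle x y).1 hz
      push_cast
      constructor <;> linarith)
  norm_num at this

theorem level_smul_standardTriangle (k : ℕ) (hk : 0 < k) :
    3 * level ((k : ℝ) • standardTriangle) = k := by
  have hset : (k : ℝ) • standardTriangle = cornerTriangle 0 k := by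
    ext ⟨x, y⟩
    rw [mem_smul_standardTriangle (by exact_mod_cast hk)]
    simp [cornerTriangle]
  have hnuc : nucleus (cornerTriangle 0 k) = cornerTriangle (k / 3 : ℕ) (k - (k / 3 : ℕ)) := by
    rw [nucleus, skinCount_cornerTriangle, peel_iterate_cornerTriangle _ _ (by omega)]
  set N := k / 3 with hN
  have hequiv : ∀ r : ℕ, 0 < r → k = 3 * N + r →
      LatticeEquivalent (nucleus (cornerTriangle 0 k)) ((r : ℝ) • standardTriangle) := by
    intro r hr hkr
    apply LatticeEquivalent.symm
    rw [hnuc, show (k : ℤ) - (N : ℕ) = r + 2 * (N : ℤ) by omega]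
    exact ⟨_, unimodular_image_lattice .., translate_smul_standardTriangle _ _ hr⟩
  have hint : ∀ r : ℕ, 0 < r → k = 3 * N + r →
      interior (nucleus (cornerTriangle 0 k)) ≠ ∅ := by
    intro r hr hkr
    rw [hnuc, interior_cornerTriangle, ← Set.nonempty_iff_ne_empty]
    have hr' : (0 : ℝ) < r := by exact_mod_cast hr
    have hkr' : (k : ℝ) = 3 * N + r := by exact_mod_cast hkr
    refine ⟨(N + r / 4, N + r / 4), ?_⟩
    simp only [Set.mem_ofPred_eq]
    push_cast
    refine ⟨?_, ?_, ?_⟩ <;> linarith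
  rw [hset, level, skinCount_cornerTriangle, ← hN]
  -- The residue of `k` modulo 3 is the size of the nucleus: a point, `Δ` or `2Δ`.
  have hcases : k = 3 * N ∨ k = 3 * N + 1 ∨ k = 3 * N + 2 := by omega
  rcases hcases with hk0 | hk1 | hk2
  · have hempty : interior (nucleus (cornerTriangle 0 k)) = ∅ := by
      rw [hnuc, interior_cornerTriangle, Set.eq_empty_iff_forall_notMem]
      rintro z ⟨h1, h2, h3⟩
      have : (k : ℝ) = 3 * N := by exact_mod_cast hk0
      push_cast at h1 h2 h3
      linarith
    rw [if_pos hempty]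
    exact_mod_cast hk0.symm
  · have h1 := hequiv 1 one_pos hk1
    rw [Nat.cast_one, one_smul] at h1
    rw [if_neg (hint 1 one_pos hk1), if_pos h1]
    have : (k : ℝ) = 3 * N + 1 := by exact_mod_cast hk1
    linarith
  · have h2 := hequiv 2 two_pos hk2
    rw [Nat.cast_ofNat] at h2
    have h1 : ¬ LatticeEquivalent (nucleus (cornerTriangle 0 k)) standardTriangle := fun h =>
      not_standardTriangle_equivalent_two (h.symm.trans h2)
    rw [if_neg (hint 2 two_pos hk2), if_neg h1, if_pos h2]
    have : (k : ℝ) = 3 * N + 2 := by exact_mod_cast hk2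
    linarith

theorem smul_standardTriangle_counts (k : ℕ) (hk : 0 < k) :
    IsConvexLatticePolygon ((k : ℝ) • standardTriangle) ∧
      (boundaryPoints ((k : ℝ) • standardTriangle) : ℝ) = 3 * k ∧
      2 * area ((k : ℝ) • standardTriangle) = k * k := by
  have hk' : (0 : ℝ) < k := by exact_mod_cast hk
  have hmem := mem_smul_standardTriangle hk'
  rw [smul_standardTriangle_eq] at hmem ⊢
  set V : Set (ℝ × ℝ) := {((0 : ℝ), (0 : ℝ)), ((k : ℝ), 0), (0, (k : ℝ))} with hVdef
  have hfin : V.Finite := by simp [hVdef]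
  have hsub : V ⊆ lattice := by
    rintro z (rfl | rfl | rfl)
    · exact ⟨(0, 0), by simp⟩
    · exact ⟨(k, 0), by simp⟩
    · exact ⟨(0, k), by simp⟩
  have hi : (interior (convexHull ℝ V)).Nonempty := by
    have hopen : IsOpen {z : ℝ × ℝ | 0 < z.1 ∧ 0 < z.2 ∧ z.1 + z.2 < k} :=
      (isOpen_lt continuous_const continuous_fst).inter
        ((isOpen_lt continuous_const continuous_snd).inter
          (isOpen_lt (continuous_fst.add continuous_snd) continuous_const))
    refine ⟨(k / 4, k / 4), interior_maximal ?_ hopen ⟨?_, ?_, ?_⟩⟩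
    · rintro ⟨x, y⟩ ⟨h1, h2, h3⟩
      exact (hmem x y).2 ⟨h1.le, h2.le, h3.le⟩
    all_goals simp only; linarith
  have hn : IsNormalized V k := by
    refine ⟨hfin, hsub, ?_, ⟨(0, 0), by simp [hVdef], rfl⟩, ⟨(k, 0), by simp [hVdef], rfl⟩, hi⟩
    rintro z (rfl | rfl | rfl) <;> simp
  have hc : IsColumns V k (fun _ => 0) (fun x => k - x) := by
    refine ⟨⟨fun x h1 h2 => (hmem _ _).2 ⟨h1, by linarith, by linarith⟩, ?_⟩,
      fun x h1 h2 => (hmem _ _).2 ⟨h1, le_rfl, by linarith⟩, ?_⟩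
    · rintro ⟨x, y⟩ hz
      have := (hmem x y).1 hz
      simp only; linarith
    · rintro ⟨x, y⟩ hz
      exact ((hmem x y).1 hz).2.1
  refine ⟨⟨⟨V, hfin, hsub, rfl⟩, hi⟩, ?_, ?_⟩
  · obtain ⟨q, rfl⟩ := Nat.exists_eq_add_of_le' hk
    rw [hc.boundaryPoints_eq hn, Finset.sum_eq_zero]
    · ring
    · intro j _
      have : (((q + 1 : ℕ) : ℝ) - ((j + 1 : ℕ) : ℝ)) = (((q : ℤ) - j : ℤ) : ℝ) := by
        push_cast; ring
      rw [this, Int.ceil_intCast, Int.floor_intCast]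
      simp
  · rw [hc.area_eq hn, trapezoid_eq_of_symm (S := k), trapezoid_eq_of_symm (S := 0)]
    · ring
    · simp
    · intro j hj
      rw [Nat.cast_sub hj]; ring

theorem level_equality_of_multiple {P : Set (ℝ × ℝ)} (hP : IsConvexLatticePolygon P)
    (h : IsMultipleOfStandardTriangle P) :
    2 * level P * boundaryPoints P = 2 * area P + 9 * level P ^ 2 := by
  obtain ⟨k, hk, Φ, hΦ, hPk⟩ := h
  obtain ⟨hT, hb, ha⟩ := smul_standardTriangle_counts k hk
  have hl := level_smul_standardTriangle k hk
  have hpT := hT.pick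
  have hpP := hP.pick
  rw [← hPk, level_image hΦ] at hl
  rw [← hPk, boundaryPoints_image hΦ] at hb
  rw [← hPk] at ha hpT
  rw [boundaryPoints_image hΦ, interiorPoints_image hΦ] at hpT
  have ha' : 2 * area P = k * k := by linarith
  rw [ha', hb, ← hl]; ring

end LatticePolygon

theorem mainTheorem3 (P : Set (ℝ × ℝ)) (hP : LatticePolygon.IsConvexLatticePolygon P)
    (a b i l : ℝ) (ha : a = LatticePolygon.area P)
    (hb : b = (LatticePolygon.boundaryPoints P : ℝ))
    (hi : i = (LatticePolygon.interiorPoints P : ℝ))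
    (hl : l = LatticePolygon.level P) (h1 : 1 ≤ l) :
    ((2 * l - 1) * b ≤ 2 * i + 9 * l ^ 2 - 2 ∧
      ((2 * l - 1) * b = 2 * i + 9 * l ^ 2 - 2 ↔
        LatticePolygon.IsMultipleOfStandardTriangle P)) ∧
    (2 * l * b ≤ 2 * a + 9 * l ^ 2 ∧
      (2 * l * b = 2 * a + 9 * l ^ 2 ↔ LatticePolygon.IsMultipleOfStandardTriangle P)) ∧
    ((4 * l - 2) * a ≤ 9 * l ^ 2 + 4 * l * (i - 1) ∧
      ((4 * l - 2) * a = 9 * l ^ 2 + 4 * l * (i - 1) ↔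
        LatticePolygon.IsMultipleOfStandardTriangle P)) := by
  obtain ⟨hle, heq⟩ := hP.level_inequality (hl ▸ h1)
  have hiff : 2 * l * b = 2 * a + 9 * l ^ 2 ↔ LatticePolygon.IsMultipleOfStandardTriangle P := by
    rw [ha, hb, hl]
    exact ⟨heq, LatticePolygon.level_equality_of_multiple hP⟩
  have hpick := hP.pick
  rw [← ha, ← hb, ← hl] at hle
  rw [← ha, ← hb, ← hi] at hpick
  -- By Pick's theorem, eliminating `a` or `b` turns the second inequality into the first or the
  -- third.
  have hbb : b = 2 * a - 2 * i + 2 := by linarith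
  refine ⟨⟨by linarith, ?_⟩, ⟨hle, hiff⟩, ⟨?_, ?_⟩⟩
  · rw [← hiff]
    constructor <;> intro h <;> linarith
  · rw [hbb] at hle
    linarith
  · rw [← hiff, hbb]
    constructor <;> intro h <;> linarith
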